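/- Let $m\ge 1$, $k\ge 0$ be integers, let $T>0$, and put $n=m(k+1)$. Consider the trivial system consisting of $m$ chains of $k+1$ integrators, with state $\tilde y=(y,\dot y,\dots,y^{(k)})\in\mathbb R^{n}$, input $\nu=y^{(k+1)}\in\mathbb R^m$ and output $y\in\mathbb R^m$, i.e. $\dot{\tilde y}=A\tilde y+B\nu$, $y=C\tilde y$, where $A$ is the block matrix with identity blocks $I_m$ on the first block superdiagonal and zeros elsewhere, $B=[0\ \cdots\ 0\ I_m]^\top$ and $C=[I_m\ 0\ \cdots\ 0]$. Let $g(\tilde y,\nu)$ be the output predictor with horizon $T$: $g(\tilde y,\nu)=C\zeta(T)$, where $\dot\zeta=A\zeta+B\nu$ with $\nu$ held constant and $\zeta(0)=\tilde y$. Apply the Newton--Raphson (NR) controller $$\dot\nu(t)=\alpha\Big(\frac{\partial g}{\partial\nu}\Big)^{-1}\big(r(t+T)-g(\tilde y(t),\nu(t))\big).$$ Then $G:=C\int_0^T e^{A\tau}\,d\tau\,B$ is nonsingular, and the closed loop is the linear system $$\dot z(t)=\begin{bmatrix}A&B\\-\alpha G^{-1}Ce^{AT}&-\alpha I\end{bmatrix}z(t)+\begin{bmatrix}0\\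 \alpha G^{-1}\end{bmatrix}r(t+T),\qquad z=(\tilde y,\nu)\in\mathbb R^{n+m}.$$ Let $P_\alpha(s)$ be the characteristic polynomial of its coefficient matrix, let $P_i(s)$ be the coefficient of $\alpha^{m-i}$ in $P_\alpha(s)$ ($0\le i\le m$), let $\tilde P_i(s)$ be the highest-degree term of $P_i(s)$, and let $Q(s)=s^{-n}\sum_{i=0}^m\tilde P_i(s)$. Then: 1. For every real $\alpha$, $$P_\alpha(s)=\Big(s^{k+2}+\alpha\,\frac{(k+1)!}{T^{k+1}}\sum_{i=0}^{k+1}\frac{T^i}{i!}s^i\Big)^m .$$ 2. $P_0(s)=\Big(\frac{(k+1)!}{T^{k+1}}\sum_{i=0}^{k+1}\frac{T^i}{i!}s^i\Big)^m$, and $P_0$ is Hurwitz (all its complex roots lie in the open left half-plane) if and only if $k\le 3$. 3. $Q(s)=(s+1)^m$. 4. If $k\le 3$, the closed loop is $\alpha$-stable with respect to $\Omega=L^\infty([0,\infty);\mathbb R^m)$ and $\Gamma=\mathbb R^{n+m}$. Here $\alpha$-stability with respect to an open $\Omega\subset L^\infty([0,\infty);\mathbb R^m)$ and a closed $\Gamma\subset\mathbb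 R^{n+m}$ means: there are $\overline\alpha>0$ and continuous nondecreasing functions $\gamma,\beta:[0,\infty)\to[0,\infty)$ such that for every $\alpha>\overline\alpha$, every $r\in\Omega$ that is bounded and continuous on $[0,\infty)$ with a bounded, piecewise continuous derivative, and every $z_0\in\Gamma$, the closed loop has a unique continuous, piecewise continuously differentiable solution $z$ on $[0,\infty)$ with $z(0)=z_0$, the Jacobian $\partial g/\partial\nu$ is nonsingular at every $z(t)$, and $\|z\|_\infty\le\gamma(\|r\|_\infty)+\beta(\|z_0\|)$. -/

import Mathlib

open scoped NNReal ENNReal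

namespace FlatNR

noncomputable section

section Time

variable {E : Type*} [NormedAddCommGroup E] [NormedSpace ℝ E]

/-- Lebesgue measure on the time axis `[0, ∞)`. -/
def timeMeasure : MeasureTheory.Measure ℝ :=
  MeasureTheory.volume.restrict (Set.Ici (0 : ℝ))

/-- `p : [0, ∞) → E` is piecewise continuous: it is continuous off the set `S`, which has finitely
many points in each bounded interval, and all its one-sided limits exist.  Values of `p` at negative
times are irrelevant. -/
structure IsPiecewiseContinuous (S : Set ℝ) (p : ℝ → E) : Prop where
  finite : ∀ b : ℝ, (S ∩ Set.Icc 0 b).Finite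
  cont : ∀ t ∈ Set.Ici (0 : ℝ) \ S, ContinuousWithinAt p (Set.Ici 0) t
  right : ∀ t : ℝ, 0 ≤ t → ∃ l : E, Filter.Tendsto p (nhdsWithin t (Set.Ioi t)) (nhds l)
  left : ∀ t : ℝ, 0 < t → ∃ l : E, Filter.Tendsto p (nhdsWithin t (Set.Iio t)) (nhds l)

/-- `p : [0, ∞) → E` is continuous and piecewise continuously differentiable, with derivative `p'`
off the set `S` (one-sided derivative at time `0`). -/
structure HasPiecewiseDeriv (S : Set ℝ) (p p' : ℝ → E) : Prop where
  cont : ContinuousOn p (Set.Ici 0)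
  pcont : IsPiecewiseContinuous S p'
  deriv : ∀ t ∈ Set.Ici (0 : ℝ) \ S, HasDerivWithinAt p (p' t) (Set.Ici 0) t

/-- The class of reference signals: bounded continuous functions on `[0, ∞)` that have
a bounded, piecewise continuous derivative. -/
def IsReference (r : ℝ → E) : Prop :=
  (∃ K : ℝ, ∀ t : ℝ, 0 ≤ t → ‖r t‖ ≤ K) ∧
  ∃ (S : Set ℝ) (r' : ℝ → E), HasPiecewiseDeriv S r r' ∧
    ∃ K : ℝ, ∀ t ∈ Set.Ici (0 : ℝ) \ S, ‖r' t‖ ≤ K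

end Time

section Controller

variable {n p : Type*} [Fintype n] [Fintype p]

/-- The state part `x` of the augmented state `z = (x, u)`. -/
def statePart (z : EuclideanSpace ℝ (n ⊕ p)) : EuclideanSpace ℝ n :=
  WithLp.toLp 2 fun i => z (Sum.inl i)

/-- The input part `u` of the augmented state `z = (x, u)`. -/
def inputPart (z : EuclideanSpace ℝ (n ⊕ p)) : EuclideanSpace ℝ p :=
  WithLp.toLp 2 fun j => z (Sum.inr j)

/-- The augmented state `(x, u)`. -/
def augment (x : EuclideanSpace ℝ n) (u : EuclideanSpace ℝ p) : EuclideanSpace ℝ (n ⊕ p) :=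
  WithLp.toLp 2 (Sum.elim x u)

/-- `ζ` solves `ζ' = f (ζ, u)` on `[0, T]` with constant input `u` and `ζ 0 = x`. -/
def IsFrozenInputSolution (f : EuclideanSpace ℝ n → EuclideanSpace ℝ p → EuclideanSpace ℝ n)
    (T : ℝ) (x : EuclideanSpace ℝ n) (u : EuclideanSpace ℝ p) (ζ : ℝ → EuclideanSpace ℝ n) : Prop :=
  ζ 0 = x ∧ ∀ τ ∈ Set.Icc 0 T, HasDerivWithinAt ζ (f (ζ τ) u) (Set.Icc 0 T) τ

/-- `g` is the output predictor with horizon `T` of the plant `x' = f (x, u)`, `y = h x`: `g x u` is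
the output at time `T` when the plant starts at `x` and its input is held at `u`. -/
def IsPredictor (f : EuclideanSpace ℝ n → EuclideanSpace ℝ p → EuclideanSpace ℝ n)
    (h : EuclideanSpace ℝ n → EuclideanSpace ℝ p) (T : ℝ)
    (g : EuclideanSpace ℝ n → EuclideanSpace ℝ p → EuclideanSpace ℝ p) : Prop :=
  ∀ x u, (∃ ζ, IsFrozenInputSolution f T x u ζ) ∧
    ∀ ζ, IsFrozenInputSolution f T x u ζ → g x u = h (ζ T)

/-- The partial Jacobian `∂g/∂u (x, u)`. -/
def inputJacobian (g : EuclideanSpace ℝ n → EuclideanSpace ℝ p → EuclideanSpace ℝ p)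
    (x : EuclideanSpace ℝ n) (u : EuclideanSpace ℝ p) :
    EuclideanSpace ℝ p →L[ℝ] EuclideanSpace ℝ p :=
  fderiv ℝ (fun v => g x v) u

/-- The partial Jacobian `∂g/∂u` exists and is nonsingular at `z = (x, u)`. -/
def IsNonsingularAt (g : EuclideanSpace ℝ n → EuclideanSpace ℝ p → EuclideanSpace ℝ p)
    (z : EuclideanSpace ℝ (n ⊕ p)) : Prop :=
  DifferentiableAt ℝ (fun v => g (statePart z) v) (inputPart z) ∧
    (inputJacobian g (statePart z) (inputPart z)).IsInvertible

/-- Right-hand side of the closed loop formed by the plant `x' = f (x, u)` and the Newton-Raphson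
controller `u' = α (∂g/∂u)⁻¹ (ρ - g (x, u))`, where `ρ` is the reference value at the time
`t + T`. -/
def closedLoopField (f : EuclideanSpace ℝ n → EuclideanSpace ℝ p → EuclideanSpace ℝ n)
    (g : EuclideanSpace ℝ n → EuclideanSpace ℝ p → EuclideanSpace ℝ p) (α : ℝ)
    (z : EuclideanSpace ℝ (n ⊕ p)) (ρ : EuclideanSpace ℝ p) : EuclideanSpace ℝ (n ⊕ p) :=
  augment (f (statePart z) (inputPart z))
    (α • (inputJacobian g (statePart z) (inputPart z)).inverse
      (ρ - g (statePart z) (inputPart z)))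

/-- `z` is a continuous, piecewise continuously differentiable solution on `[0, ∞)` of the closed
loop with reference `r` and initial condition `z₀`. -/
def IsClosedLoopSolution (f : EuclideanSpace ℝ n → EuclideanSpace ℝ p → EuclideanSpace ℝ n)
    (g : EuclideanSpace ℝ n → EuclideanSpace ℝ p → EuclideanSpace ℝ p) (T α : ℝ)
    (r : ℝ → EuclideanSpace ℝ p) (z₀ : EuclideanSpace ℝ (n ⊕ p))
    (z : ℝ → EuclideanSpace ℝ (n ⊕ p)) : Prop :=
  z 0 = z₀ ∧ ∃ (S : Set ℝ) (z' : ℝ → EuclideanSpace ℝ (n ⊕ p)), HasPiecewiseDeriv S z z' ∧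
    ∀ t ∈ Set.Ici (0 : ℝ) \ S,
      IsNonsingularAt g (z t) ∧ z' t = closedLoopField f g α (z t) (r (t + T))

/-- `α`-stability of the closed loop (plant `f`, predictor `g`, horizon `T`) with respect to an open
set `Ω` of `L^∞` and a closed set `Γ` of initial conditions. The trajectory is well-defined (it is
the unique solution), nonsingular, and bounded uniformly in `α`. -/
def AlphaStable (f : EuclideanSpace ℝ n → EuclideanSpace ℝ p → EuclideanSpace ℝ n)
    (g : EuclideanSpace ℝ n → EuclideanSpace ℝ p → EuclideanSpace ℝ p) (T : ℝ)
    (Ω : TopologicalSpace.Opens (MeasureTheory.Lp (EuclideanSpace ℝ p) ∞ timeMeasure))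
    (Γ : TopologicalSpace.Closeds (EuclideanSpace ℝ (n ⊕ p))) : Prop :=
  ∃ αbar : ℝ, 0 < αbar ∧ ∃ γ β : ℝ≥0 → ℝ≥0,
    Continuous γ ∧ Monotone γ ∧ Continuous β ∧ Monotone β ∧
    ∀ α : ℝ, αbar < α →
    ∀ (r : ℝ → EuclideanSpace ℝ p) (hr : MeasureTheory.MemLp r ∞ timeMeasure),
      hr.toLp r ∈ Ω → IsReference r →
    ∀ z₀ ∈ Γ, ∃ z : ℝ → EuclideanSpace ℝ (n ⊕ p),
      IsClosedLoopSolution f g T α r z₀ z ∧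
      (∀ w, IsClosedLoopSolution f g T α r z₀ w → Set.EqOn w z (Set.Ici 0)) ∧
      (∀ t : ℝ, 0 ≤ t → IsNonsingularAt g (z t)) ∧
      MeasureTheory.eLpNorm z ∞ timeMeasure ≤ ((γ ‖hr.toLp r‖₊ + β ‖z₀‖₊ : ℝ≥0) : ℝ≥0∞)

end Controller

section Linear

variable {n p : Type*} [Fintype n] [Fintype p] [DecidableEq n] [DecidableEq p]

/-- The linear dynamics `A x + B u`. -/
def linearField (A : Matrix n n ℝ) (B : Matrix n p ℝ)
    (x : EuclideanSpace ℝ n) (u : EuclideanSpace ℝ p) : EuclideanSpace ℝ n :=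
  WithLp.toLp 2 (A.mulVec x + B.mulVec u)

/-- The linear output `C x`. -/
def linearOutput (C : Matrix p n ℝ) (x : EuclideanSpace ℝ n) : EuclideanSpace ℝ p :=
  WithLp.toLp 2 (C.mulVec x)

/-- The matrix `∫₀ᵀ e^{A τ} dτ`, integrated entry by entry. -/
def expIntegral (A : Matrix n n ℝ) (T : ℝ) : Matrix n n ℝ :=
  Matrix.of fun i j => ∫ τ in (0 : ℝ)..T, NormedSpace.exp (τ • A) i j

/-- The matrix `C (∫₀ᵀ e^{A τ} dτ) B`. -/
def gain (A : Matrix n n ℝ) (B : Matrix n p ℝ) (C : Matrix p n ℝ) (T : ℝ) : Matrix p p ℝ :=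
  C * expIntegral A T * B

/-- The coefficient matrix of the augmented state of the closed loop,
`[[A, B], [-α (C ∫₀ᵀ e^{A τ} dτ B)⁻¹ C e^{A T}, -α I]]`. The factor `α` may be a real number or
an indeterminate. -/
def augmentedMatrix {R : Type*} [CommRing R] [Algebra ℝ R]
    (A : Matrix n n ℝ) (B : Matrix n p ℝ) (C : Matrix p n ℝ) (T : ℝ) (α : R) :
    Matrix (n ⊕ p) (n ⊕ p) R :=
  Matrix.fromBlocks (A.map (algebraMap ℝ R)) (B.map (algebraMap ℝ R))
    (-(α • ((gain A B C T)⁻¹ * C * NormedSpace.exp (T • A)).map (algebraMap ℝ R)))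
    (-(α • (1 : Matrix p p R)))

/-- The coefficient matrix `[[0], [α (C ∫₀ᵀ e^{A τ} dτ B)⁻¹]]` of the reference in the
closed loop. -/
def referenceMatrix (A : Matrix n n ℝ) (B : Matrix n p ℝ) (C : Matrix p n ℝ) (T α : ℝ) :
    Matrix (n ⊕ p) p ℝ :=
  Matrix.fromRows 0 (α • (gain A B C T)⁻¹)

/-- The closed-loop characteristic polynomial `P_α(s)`. -/
def charPoly (A : Matrix n n ℝ) (B : Matrix n p ℝ) (C : Matrix p n ℝ) (T α : ℝ) :
    Polynomial ℝ :=
  (augmentedMatrix A B C T α).charpoly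

/-- `P_i(s)`, the coefficient of `α ^ (m - i)` in `P_α(s)`, where `m` is the number of inputs. The
polynomial `P_α(s)` is formed with an indeterminate `α` and rearranged by powers of `α`. -/
def charPolyCoeff (A : Matrix n n ℝ) (B : Matrix n p ℝ) (C : Matrix p n ℝ) (T : ℝ) (i : ℕ) :
    Polynomial ℝ :=
  (Polynomial.Bivariate.swap (R := ℝ)
    (augmentedMatrix A B C T (Polynomial.X : Polynomial ℝ)).charpoly).coeff (Fintype.card p - i)

/-- The highest-degree term of a polynomial. -/
def leadingTerm (q : Polynomial ℝ) : Polynomial ℝ :=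
  Polynomial.monomial q.natDegree q.leadingCoeff

/-- `Q(s) = s⁻ⁿ ∑_{i=0}^m` (highest-degree term of `P_i(s)`), where `n` is the dimension of
the state and `m` the number of inputs. -/
def fastPoly (A : Matrix n n ℝ) (B : Matrix n p ℝ) (C : Matrix p n ℝ) (T : ℝ) : RatFunc ℝ :=
  algebraMap (Polynomial ℝ) (RatFunc ℝ)
      (∑ i ∈ Finset.range (Fintype.card p + 1), leadingTerm (charPolyCoeff A B C T i)) /
    RatFunc.X ^ Fintype.card n

/-- All complex roots lie in the open left half-plane. -/
def IsHurwitz (q : Polynomial ℝ) : Prop :=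
  ∀ s : ℂ, Polynomial.aeval s q = 0 → s.re < 0

end Linear

section Trivial

/-- The matrix `A` of `m` chains of `k + 1` integrators. The state consists of the blocks
`y, y', …, y^(k)`, each of dimension `m`; the index `(i, a)` denotes component `a` of `y^(i)`. -/
def chainA (m k : ℕ) : Matrix (Fin (k + 1) × Fin m) (Fin (k + 1) × Fin m) ℝ :=
  Matrix.of fun i j => if (j.1 : ℕ) = (i.1 : ℕ) + 1 ∧ i.2 = j.2 then 1 else 0

/-- The input `y^(k+1)` drives the last block. -/
def chainB (m k : ℕ) : Matrix (Fin (k + 1) × Fin m) (Fin m) ℝ :=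
  Matrix.of fun i b => if i.1 = Fin.last k ∧ i.2 = b then 1 else 0

/-- The output is the first block, `y`. -/
def chainC (m k : ℕ) : Matrix (Fin m) (Fin (k + 1) × Fin m) ℝ :=
  Matrix.of fun a j => if j.1 = 0 ∧ a = j.2 then 1 else 0

end Trivial

end

end FlatNR

/-! The matrix `A` is nilpotent, so `e^{At}` is explicit and `G = T^(k+1)/(k+1)! · I`. The feedback
therefore acts on each of the `m` chains separately, and the closed loop is `m` copies of one
companion system with characteristic polynomial `s^(k+2) + α p(s)`, where `p` (`slowPoly`) is monic
of degree `k + 1`. This computation (`det_companion_pencil`, `chain_augmentedMatrix_charpoly`) is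
valid over any commutative `ℝ`-algebra. Taking `α` to be an indeterminate gives `P_i = binom(m,i)
p^(m-i) s^((k+2)i)`, and the leading terms add up to `s^n (s+1)^m`.

Up to a nonzero factor, `p(s)` is `e_{k+1}(Ts)`, where `e_N` is the Taylor polynomial of the
exponential. Since `e_N' = e_{N-1}`, Gauss-Lucas makes the Hurwitz property pass from `e_N` to every
smaller index, so only two cases matter. `e_4` is Hurwitz by elimination of the imaginary part.
`e_5` is not: a nonconstant Hurwitz `q` satisfies `|q(-s)| < |q(s)|` for `Re s > 0`, whereas the odd
part of `e_5` vanishes at a point of the right half-plane.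

For stability the bound must be uniform in `α`. Put `w = p(d/dt) y`, which includes the input as
`y^(k+1)`. Then `w' = -α w + α d r(t+T) + v`, where `d = (k+1)!/T^(k+1)` and `v` is a combination of
`y', …, y^(k+1)`. Because `p` is Hurwitz, these derivatives are bounded by `sup |w|` and the initial
values, with a constant free of `α` (`isDominated_of_degree_lt`). The fast equation divides `v` by
`α`, so for large `α` its contribution is absorbed into the left side (`exists_chain_bound`). -/

namespace FlatNR

/-! ### Explicit exponential, gain and feedback of the integrator chains -/

section ChainMatrices

variable {m k : ℕ}

theorem chainA_pow_apply (n : ℕ) (i j : Fin (k + 1) × Fin m) :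
    (chainA m k ^ n) i j = if (j.1 : ℕ) = (i.1 : ℕ) + n ∧ i.2 = j.2 then 1 else 0 := by
  induction n generalizing j with
  | zero =>
    obtain ⟨i, a⟩ := i
    obtain ⟨j, b⟩ := j
    simp only [pow_zero, Matrix.one_apply, Prod.mk.injEq, add_zero, Fin.ext_iff]
    congr 1
    simp only [eq_comm]
  | succ n ih =>
    rw [pow_succ, Matrix.mul_apply]
    simp only [ih]
    by_cases h : (i.1 : ℕ) + n < k + 1
    · rw [Finset.sum_eq_single (⟨(i.1 : ℕ) + n, h⟩, i.2)]
      · simp [chainA, add_assoc]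
      · rintro ⟨l, c⟩ - hne
        rw [if_neg, zero_mul]
        rintro ⟨h1, h2⟩
        exact hne (Prod.ext (Fin.ext h1) h2.symm)
      · simp
    · rw [Finset.sum_eq_zero, if_neg]
      · rintro ⟨h1, -⟩
        have := j.1.isLt
        omega
      · intro l _
        rw [if_neg, zero_mul]
        rintro ⟨h1, -⟩
        have := l.1.isLt
        omega

/-- Nilpotency truncates the exponential series, and each entry receives at most one of the
remaining powers. -/
theorem exp_chainA_apply (t : ℝ) (i j : Fin (k + 1) × Fin m) :
    NormedSpace.exp (t • chainA m k) i j =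
      if (i.1 : ℕ) ≤ (j.1 : ℕ) ∧ i.2 = j.2 then
        t ^ ((j.1 : ℕ) - (i.1 : ℕ)) / (Nat.factorial ((j.1 : ℕ) - (i.1 : ℕ)) : ℝ) else 0 := by
  have hz : ∀ n, k + 1 ≤ n → chainA m k ^ n = 0 := by
    intro n hn
    ext i j
    rw [chainA_pow_apply, if_neg, Matrix.zero_apply]
    rintro ⟨h, -⟩
    have := j.1.isLt
    omega
  rw [NormedSpace.exp_eq_tsum ℝ]
  simp only
  rw [tsum_eq_sum (s := Finset.range (k + 1)), Matrix.sum_apply]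
  · simp only [smul_pow, Matrix.smul_apply, chainA_pow_apply, smul_eq_mul]
    by_cases h : (i.1 : ℕ) ≤ (j.1 : ℕ) ∧ i.2 = j.2
    · rw [if_pos h, Finset.sum_eq_single ((j.1 : ℕ) - (i.1 : ℕ))]
      · rw [if_pos ⟨by omega, h.2⟩, mul_one, inv_mul_eq_div]
      · intro n _ hn
        rw [if_neg (fun h' => hn (by omega))]
        simp
      · intro hn
        have := j.1.isLt
        simp only [Finset.mem_range] at hn
        omega
    · rw [if_neg h]
      refine Finset.sum_eq_zero fun n _ => ?_
      rw [if_neg (fun h' => h ⟨by omega, h'.2⟩)]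
      simp
  · intro n hn
    rw [smul_pow, hz n (by simpa using hn)]
    simp

/-- The entries of `C M` are those of the first block row of `M`. -/
theorem chainC_mul_apply {ι : Type*} (M : Matrix (Fin (k + 1) × Fin m) ι ℝ) (a : Fin m) (j : ι) :
    (chainC m k * M) a j = M (0, a) j := by
  rw [Matrix.mul_apply, Finset.sum_eq_single (0, a)]
  · simp [chainC]
  · rintro ⟨l, c⟩ - hne
    have : ¬ (l = 0 ∧ a = c) := fun h => hne (Prod.ext h.1 h.2.symm)
    simp [chainC, this]
  · simp

/-- The entries of `M B` are those of the last block column of `M`. -/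
theorem mul_chainB_apply {ι : Type*} (M : Matrix ι (Fin (k + 1) × Fin m) ℝ) (i : ι) (b : Fin m) :
    (M * chainB m k) i b = M i (Fin.last k, b) := by
  rw [Matrix.mul_apply, Finset.sum_eq_single (Fin.last k, b)]
  · simp [chainB]
  · rintro ⟨l, c⟩ - hne
    have : ¬ (l = Fin.last k ∧ c = b) := fun h => hne (Prod.ext h.1 h.2)
    simp [chainB, this]
  · simp

theorem chainGain_eq (m k : ℕ) (T : ℝ) :
    gain (chainA m k) (chainB m k) (chainC m k) T =
      (T ^ (k + 1) / (Nat.factorial (k + 1) : ℝ)) • (1 : Matrix (Fin m) (Fin m) ℝ) := by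
  ext a b
  rw [gain, mul_chainB_apply, chainC_mul_apply, expIntegral, Matrix.of_apply]
  simp only [exp_chainA_apply, Fin.val_zero, zero_le, true_and, Fin.val_last, tsub_zero,
    Matrix.smul_apply, Matrix.one_apply, smul_eq_mul]
  by_cases h : a = b
  · have hk : ((k : ℝ) + 1) ≠ 0 := by positivity
    have hf : (Nat.factorial k : ℝ) ≠ 0 := by positivity
    simp only [h, if_true, intervalIntegral.integral_div, integral_pow, Nat.factorial_succ]
    push_cast
    field_simp
    simp
  · simp [h]

theorem chainGain_inv (m k : ℕ) {T : ℝ} (hT : T ≠ 0) :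
    (gain (chainA m k) (chainB m k) (chainC m k) T)⁻¹ =
      ((Nat.factorial (k + 1) : ℝ) / T ^ (k + 1)) • (1 : Matrix (Fin m) (Fin m) ℝ) := by
  apply Matrix.inv_eq_left_inv
  have hf : (Nat.factorial (k + 1) : ℝ) ≠ 0 := by positivity
  rw [chainGain_eq, smul_mul_smul, mul_one]
  have : (Nat.factorial (k + 1) : ℝ) / T ^ (k + 1) * (T ^ (k + 1) / (Nat.factorial (k + 1) : ℝ))
      = 1 := by field_simp
  rw [this, one_smul]

theorem isUnit_chainGain (m k : ℕ) {T : ℝ} (hT : T ≠ 0) :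
    IsUnit (gain (chainA m k) (chainB m k) (chainC m k) T) := by
  rw [chainGain_eq, Matrix.isUnit_iff_isUnit_det, Matrix.det_smul, Matrix.det_one, mul_one]
  exact ((div_ne_zero (pow_ne_zero _ hT) (by positivity)).isUnit).pow _

/-- The feedback matrix `G⁻¹ C e^{AT}` of `m` integrator chains. -/
theorem chainFeedback_apply {T : ℝ} (hT : T ≠ 0) (a : Fin m) (j : Fin (k + 1) × Fin m) :
    ((gain (chainA m k) (chainB m k) (chainC m k) T)⁻¹ * chainC m k *
        NormedSpace.exp (T • chainA m k)) a j =
      if a = j.2 then ((Nat.factorial (k + 1) : ℝ) / T ^ (k + 1)) *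
        (T ^ (j.1 : ℕ) / (Nat.factorial (j.1 : ℕ) : ℝ)) else 0 := by
  rw [chainGain_inv m k hT, Matrix.mul_assoc, Matrix.smul_mul, Matrix.one_mul, Matrix.smul_apply,
    chainC_mul_apply, exp_chainA_apply]
  simp

end ChainMatrices

/-! ### Closed-loop characteristic polynomial -/

section CharPoly

/-- Laplace expansion along the first column, where only the top and bottom entries survive. The top
minor is a smaller pencil with shifted coefficients; the bottom minor is triangular with `-1` on the
diagonal, and its sign cancels the cofactor sign. -/
theorem det_companion_pencil {R : Type*} [CommRing R] (n : ℕ) (s : R) (c : Fin (n + 1) → R) :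
    (Matrix.of fun i j : Fin (n + 1) => (if i = j then s else 0) -
      (if (j : ℕ) = (i : ℕ) + 1 then 1 else 0) + (if i = Fin.last n then c j else 0)).det =
      s ^ (n + 1) + ∑ i, c i * s ^ (i : ℕ) := by
  induction n with
  | zero => simp
  | succ n ih =>
    rw [Matrix.det_succ_column_zero, Fin.sum_univ_succ, Fin.sum_univ_castSucc,
      Finset.sum_eq_zero]
    · have h0 : (Matrix.of fun i j : Fin (n + 2) => (if i = j then s else 0) -
          (if (j : ℕ) = (i : ℕ) + 1 then 1 else 0) +
          (if i = Fin.last (n + 1) then c j else 0)).submatrix (Fin.succAbove 0) Fin.succ =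
          Matrix.of fun i j : Fin (n + 1) => (if i = j then s else 0) -
            (if (j : ℕ) = (i : ℕ) + 1 then 1 else 0) +
            (if i = Fin.last n then c j.succ else 0) := by
        ext i j
        simp [Fin.ext_iff]
      have h1 : ((Matrix.of fun i j : Fin (n + 2) => (if i = j then s else 0) -
          (if (j : ℕ) = (i : ℕ) + 1 then 1 else 0) +
          (if i = Fin.last (n + 1) then c j else 0)).submatrix
            (Fin.succAbove (Fin.last n).succ) Fin.succ).det = (-1) ^ (n + 1) := by
        rw [Matrix.det_of_isLowerTriangular]
        · have hne : ∀ i : Fin (n + 1), ¬ ((i : ℕ) = n + 1) := fun i => by omega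
          simp [Fin.ext_iff, Fin.succ_last, hne]
        · intro i j hij
          have hij' : (i : ℕ) < j := hij
          have := i.isLt
          have h1 : ¬ ((i : ℕ) = j + 1) := by omega
          have h2 : ¬ ((j : ℕ) = i) := by omega
          have h3 : ¬ ((i : ℕ) = n + 1) := by omega
          simp [Fin.ext_iff, Fin.succ_last, h1, h2, h3]
      rw [h0, h1, ih]
      have e : (-1 : R) ^ (n + 1) * (-1) ^ (n + 1) = 1 := by
        rw [← mul_pow]; simp
      rw [Fin.sum_univ_succ (n := n + 1)]
      simp only [Fin.val_succ, pow_succ _ (_ : ℕ), ← mul_assoc, ← Finset.sum_mul]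
      simp [Fin.ext_iff]
      linear_combination (c 0) * e
    · intro i _
      have := i.isLt
      have h3 : ¬ ((i : ℕ) = n) := by omega
      simp [Fin.ext_iff, h3]

/-- The index equivalence that appends the input to each chain. -/
def chainEquiv (m k : ℕ) : (Fin (k + 1) × Fin m) ⊕ Fin m ≃ Fin (k + 2) × Fin m where
  toFun := Sum.elim (fun p => (p.1.castSucc, p.2)) fun b => (Fin.last (k + 1), b)
  invFun p := Fin.lastCases (motive := fun _ => (Fin (k + 1) × Fin m) ⊕ Fin m)
    (Sum.inr p.2) (fun i => Sum.inl (i, p.2)) p.1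
  left_inv := by rintro (⟨i, a⟩ | b) <;> simp
  right_inv := by
    rintro ⟨i, a⟩
    refine Fin.lastCases ?_ (fun i => ?_) i <;> simp

/-- Appending the input to each chain makes the characteristic matrix block diagonal with identical
companion blocks. The ring is left general so that `α` can be a real number or an indeterminate. -/
theorem chain_augmentedMatrix_charpoly {R : Type*} [CommRing R] [Algebra ℝ R] (m k : ℕ) {T : ℝ}
    (hT : T ≠ 0) (α : R) :
    (augmentedMatrix (chainA m k) (chainB m k) (chainC m k) T α).charpoly =
      (Polynomial.X ^ (k + 2) + ∑ i ∈ Finset.range (k + 2),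
        Polynomial.C (α * algebraMap ℝ R (((Nat.factorial (k + 1) : ℝ) / T ^ (k + 1)) *
          (T ^ i / (Nat.factorial i : ℝ)))) * Polynomial.X ^ i) ^ m := by
  set c : Fin (k + 2) → Polynomial R := fun i =>
    Polynomial.C (α * algebraMap ℝ R (((Nat.factorial (k + 1) : ℝ) / T ^ (k + 1)) *
          (T ^ (i : ℕ) / (Nat.factorial (i : ℕ) : ℝ)))) with hc
  -- The feedback formula, continued to index `k + 1`, yields exactly the block `-α I`, so the input
  -- needs no separate coefficient.
  have hlast : c (Fin.last (k + 1)) = Polynomial.C α := by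
    have : (Nat.factorial (k + 1) : ℝ) / T ^ (k + 1) * (T ^ (k + 1) / (Nat.factorial (k + 1) : ℝ))
      = 1 := by
      have hf : (Nat.factorial (k + 1) : ℝ) ≠ 0 := by positivity
      field_simp
    simp only [hc, Fin.val_last, this, map_one, mul_one]
  have hite : ∀ (p : Prop) [Decidable p], Polynomial.C (algebraMap ℝ R (if p then 1 else 0)) =
      if p then 1 else 0 := by
    intro p _
    split_ifs <;> simp
  have key : (augmentedMatrix (chainA m k) (chainB m k) (chainC m k) T α).charmatrix =
      (Matrix.blockDiagonal fun _ : Fin m => Matrix.of fun i j : Fin (k + 2) =>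
        (if i = j then Polynomial.X else 0) - (if (j : ℕ) = (i : ℕ) + 1 then 1 else 0) +
          (if i = Fin.last (k + 1) then c j else 0)).submatrix (chainEquiv m k)
            (chainEquiv m k) := by
    ext1 x y
    rw [Matrix.charmatrix_apply, Matrix.submatrix_apply, Matrix.blockDiagonal_apply,
      Matrix.diagonal_apply, augmentedMatrix]
    rcases x with ⟨i, a⟩ | a <;> rcases y with ⟨j, b⟩ | b
    · have := i.isLt
      have h1 : ¬ ((i : ℕ) = k + 1) := by omega
      rw [Matrix.fromBlocks_apply₁₁, Matrix.map_apply, chainA, Matrix.of_apply, hite]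
      by_cases hab : a = b <;> simp [chainEquiv, Fin.ext_iff, h1, hab]
    · have := i.isLt
      have h1 : ¬ ((i : ℕ) = k + 1) := by omega
      have h2 : (k = (i : ℕ)) = ((i : ℕ) = k) := by simp only [eq_comm]
      rw [Matrix.fromBlocks_apply₁₂, Matrix.map_apply, chainB, Matrix.of_apply, hite]
      by_cases hab : a = b <;> simp [chainEquiv, Fin.ext_iff, h1, hab, h2]
    · have := j.isLt
      have h2 : ¬ (k + 1 = (j : ℕ)) := by omega
      have h3 : ¬ ((j : ℕ) = k + 1 + 1) := by omega
      rw [Matrix.fromBlocks_apply₂₁, Matrix.neg_apply, Matrix.smul_apply, Matrix.map_apply,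
        chainFeedback_apply hT]
      by_cases hab : a = b <;> simp [chainEquiv, Fin.ext_iff, h2, h3, hab, hc]
    · rw [Matrix.fromBlocks_apply₂₂, Matrix.neg_apply, Matrix.smul_apply, Matrix.one_apply]
      by_cases hab : a = b <;> simp [chainEquiv, hab, hlast]
  rw [Matrix.charpoly, key, Matrix.det_submatrix_equiv_self, Matrix.det_blockDiagonal]
  simp only [det_companion_pencil, Finset.prod_const, Finset.card_univ, Fintype.card_fin, hc]
  rw [Finset.sum_range]

end CharPoly

/-! ### The polynomials `P_i` and `Q` -/

section ChainPoly

/-- The polynomial `(k+1)!/T^(k+1) · ∑_{i ≤ k+1} T^i/i! s^i`, which is monic of degree `k + 1`. -/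
noncomputable def slowPoly (k : ℕ) (T : ℝ) : Polynomial ℝ :=
  Polynomial.C ((Nat.factorial (k + 1) : ℝ) / T ^ (k + 1)) *
    ∑ i ∈ Finset.range (k + 2), Polynomial.C (T ^ i / (Nat.factorial i : ℝ)) * Polynomial.X ^ i

theorem slowPoly_eq_sum (k : ℕ) (T : ℝ) :
    slowPoly k T = ∑ i ∈ Finset.range (k + 2),
      Polynomial.C (((Nat.factorial (k + 1) : ℝ) / T ^ (k + 1)) *
        (T ^ i / (Nat.factorial i : ℝ))) * Polynomial.X ^ i := by
  rw [slowPoly, Finset.mul_sum]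
  refine Finset.sum_congr rfl fun i _ => ?_
  rw [Polynomial.C_mul, mul_assoc]

theorem slowPoly_coeff (k : ℕ) (T : ℝ) (i : ℕ) :
    (slowPoly k T).coeff i = if i < k + 2 then ((Nat.factorial (k + 1) : ℝ) / T ^ (k + 1)) *
        (T ^ i / (Nat.factorial i : ℝ)) else 0 := by
  rw [slowPoly_eq_sum, Polynomial.finsetSum_coeff]
  simp only [Polynomial.coeff_C_mul_X_pow, Finset.sum_ite_eq, Finset.mem_range]

theorem slowPoly_natDegree_le (k : ℕ) (T : ℝ) : (slowPoly k T).natDegree ≤ k + 1 := by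
  rw [Polynomial.natDegree_le_iff_coeff_eq_zero]
  intro N hN
  rw [slowPoly_coeff, if_neg (by omega)]

theorem slowPoly_coeff_top (k : ℕ) {T : ℝ} (hT : T ≠ 0) : (slowPoly k T).coeff (k + 1) = 1 := by
  rw [slowPoly_coeff, if_pos (by omega)]
  have hf : (Nat.factorial (k + 1) : ℝ) ≠ 0 := by positivity
  field_simp

theorem slowPoly_monic (k : ℕ) {T : ℝ} (hT : T ≠ 0) : (slowPoly k T).Monic :=
  Polynomial.monic_of_natDegree_le_of_coeff_eq_one (k + 1) (slowPoly_natDegree_le k T)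
    (slowPoly_coeff_top k hT)

theorem slowPoly_natDegree (k : ℕ) {T : ℝ} (hT : T ≠ 0) : (slowPoly k T).natDegree = k + 1 :=
  le_antisymm (slowPoly_natDegree_le k T)
    (Polynomial.le_natDegree_of_ne_zero (by rw [slowPoly_coeff_top k hT]; exact one_ne_zero))

theorem chain_charPoly (m k : ℕ) {T : ℝ} (hT : T ≠ 0) (α : ℝ) :
    charPoly (chainA m k) (chainB m k) (chainC m k) T α =
      (Polynomial.X ^ (k + 2) +
        Polynomial.C (α * ((Nat.factorial (k + 1) : ℝ) / T ^ (k + 1))) *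
          ∑ i ∈ Finset.range (k + 2),
            Polynomial.C (T ^ i / (Nat.factorial i : ℝ)) * Polynomial.X ^ i) ^ m := by
  rw [charPoly, chain_augmentedMatrix_charpoly m k hT, Finset.mul_sum]
  congr 2
  refine Finset.sum_congr rfl fun i _ => ?_
  rw [← mul_assoc, ← Polynomial.C_mul]
  simp only [Algebra.algebraMap_self, RingHom.id_apply, mul_assoc]

theorem coeff_add_X_mul_C_pow {R : Type*} [CommRing R] (a b : R) (m j : ℕ) (hj : j ≤ m) :
    ((Polynomial.C a + Polynomial.X * Polynomial.C b) ^ m).coeff j =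
      (m.choose j : R) * b ^ j * a ^ (m - j) := by
  rw [add_comm, add_pow, Polynomial.finsetSum_coeff, Finset.sum_eq_single j]
  · rw [mul_pow, ← Polynomial.C_pow, ← Polynomial.C_pow, ← Polynomial.C_eq_natCast,
      mul_assoc, mul_assoc, ← Polynomial.C_mul, ← Polynomial.C_mul, Polynomial.coeff_X_pow_mul',
      if_pos le_rfl, Nat.sub_self, Polynomial.coeff_C_zero]
    ring
  · intro i _ hij
    rw [mul_pow, ← Polynomial.C_pow, ← Polynomial.C_pow, ← Polynomial.C_eq_natCast,
      mul_assoc, mul_assoc, ← Polynomial.C_mul, ← Polynomial.C_mul,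
      Polynomial.X_pow_mul_C, Polynomial.coeff_C_mul_X_pow, if_neg (Ne.symm hij)]
  · intro h
    simp only [Finset.mem_range] at h
    omega

/-- Exchanging the variables turns the characteristic polynomial into `(s^(k+2) + α p(s))^m`, read
as a polynomial in `α`; the binomial theorem does the rest. -/
theorem chain_charPolyCoeff (m k : ℕ) {T : ℝ} (hT : T ≠ 0) (i : ℕ) (hi : i ≤ m) :
    charPolyCoeff (chainA m k) (chainB m k) (chainC m k) T i =
      (m.choose i : Polynomial ℝ) * slowPoly k T ^ (m - i) * Polynomial.X ^ ((k + 2) * i) := by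
  have h : Polynomial.Bivariate.swap (R := ℝ) (augmentedMatrix (chainA m k) (chainB m k)
      (chainC m k) T (Polynomial.X : Polynomial ℝ)).charpoly =
      (Polynomial.C (Polynomial.X ^ (k + 2)) + Polynomial.X * Polynomial.C (slowPoly k T)) ^ m := by
    rw [chain_augmentedMatrix_charpoly m k hT, map_pow, map_add, map_pow,
      Polynomial.Bivariate.swap_Y, slowPoly_eq_sum, map_sum, map_sum, Polynomial.C_pow,
      Finset.mul_sum]
    congr 2
    refine Finset.sum_congr rfl fun i _ => ?_
    rw [map_mul, map_pow, Polynomial.C_mul, map_mul, Polynomial.Bivariate.swap_Y,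
      Polynomial.Bivariate.swap_X, ← Polynomial.C_eq_algebraMap, Polynomial.Bivariate.swap_C_C,
      Polynomial.C_mul (a := Polynomial.C _), Polynomial.C_pow, mul_assoc]
  rw [charPolyCoeff, h, Fintype.card_fin, coeff_add_X_mul_C_pow _ _ _ _ (Nat.sub_le _ _),
    Nat.choose_symm hi, Nat.sub_sub_self hi, ← pow_mul]

theorem chain_charPolyCoeff_zero (m k : ℕ) {T : ℝ} (hT : T ≠ 0) :
    charPolyCoeff (chainA m k) (chainB m k) (chainC m k) T 0 = slowPoly k T ^ m := by
  rw [chain_charPolyCoeff m k hT 0 (Nat.zero_le m)]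
  simp

theorem leadingTerm_natCast_mul_of_monic {p : Polynomial ℝ} (hp : p.Monic) {c : ℕ} (hc : c ≠ 0) :
    leadingTerm ((c : Polynomial ℝ) * p) = (c : Polynomial ℝ) * Polynomial.X ^ p.natDegree := by
  have hc' : (c : ℝ) ≠ 0 := Nat.cast_ne_zero.mpr hc
  rw [leadingTerm, ← Polynomial.C_eq_natCast, Polynomial.natDegree_C_mul hc',
    Polynomial.leadingCoeff_mul, hp.leadingCoeff, mul_one, Polynomial.leadingCoeff_C,
    Polynomial.C_mul_X_pow_eq_monomial]

/-- The degree of `P_i` is `(k+1)(m-i) + (k+2)i = n + i`, so the leading terms form the binomial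
expansion of `(s+1)^m` times `s^n`. -/
theorem chain_fastPoly (m k : ℕ) {T : ℝ} (hT : T ≠ 0) :
    fastPoly (chainA m k) (chainB m k) (chainC m k) T =
      algebraMap (Polynomial ℝ) (RatFunc ℝ) ((Polynomial.X + 1) ^ m) := by
  have h : ∑ i ∈ Finset.range (m + 1),
      leadingTerm (charPolyCoeff (chainA m k) (chainB m k) (chainC m k) T i) =
      (Polynomial.X + 1) ^ m * Polynomial.X ^ ((k + 1) * m) := by
    rw [add_pow, Finset.sum_mul]
    refine Finset.sum_congr rfl fun i hi => ?_
    have hi' : i ≤ m := Nat.lt_succ_iff.mp (Finset.mem_range.mp hi)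
    have hm : (slowPoly k T ^ (m - i) * Polynomial.X ^ ((k + 2) * i)).Monic :=
      ((slowPoly_monic k hT).pow _).mul (Polynomial.monic_X_pow _)
    rw [chain_charPolyCoeff m k hT i hi', mul_assoc,
      leadingTerm_natCast_mul_of_monic hm (Nat.choose_pos hi').ne',
      ((slowPoly_monic k hT).pow _).natDegree_mul (Polynomial.monic_X_pow _),
      (slowPoly_monic k hT).natDegree_pow, Polynomial.natDegree_X_pow, slowPoly_natDegree k hT]
    obtain ⟨j, rfl⟩ := Nat.exists_eq_add_of_le hi'
    rw [Nat.add_sub_cancel_left]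
    ring
  rw [fastPoly, Fintype.card_fin, h, Fintype.card_prod, Fintype.card_fin, Fintype.card_fin,
    map_mul, map_pow (algebraMap (Polynomial ℝ) (RatFunc ℝ)) Polynomial.X, RatFunc.algebraMap_X,
    mul_div_cancel_right₀]
  exact pow_ne_zero _ RatFunc.X_ne_zero

end ChainPoly

/-! ### Hurwitz property of the exponential Taylor polynomials -/

section Hurwitz

/-- Gauss-Lucas: critical points lie in the convex hull of the roots, and the open half-plane is
convex. -/
theorem IsHurwitz.derivative {q : Polynomial ℝ} (hq : IsHurwitz q)
    (h : Polynomial.derivative q ≠ 0) : IsHurwitz (Polynomial.derivative q) := by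
  intro s hs
  set Q := q.map (algebraMap ℝ ℂ) with hQ
  have hd : Polynomial.derivative Q ≠ 0 := by
    rw [hQ, Polynomial.derivative_map]
    exact (Polynomial.map_ne_zero_iff (algebraMap ℝ ℂ).injective).mpr h
  have hdeg : 0 < Q.degree := by
    by_contra hcon
    rw [Polynomial.eq_C_of_degree_le_zero (not_lt.mp hcon)] at hd
    simp at hd
  have hmem : s ∈ Q.derivative.rootSet ℂ := by
    rw [Polynomial.mem_rootSet]
    refine ⟨hd, ?_⟩
    rw [hQ, Polynomial.derivative_map, Polynomial.aeval_map_algebraMap]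
    exact hs
  have hsub : Q.rootSet ℂ ⊆ {z : ℂ | z.re < 0} := by
    intro z hz
    rw [Polynomial.mem_rootSet, hQ, Polynomial.aeval_map_algebraMap] at hz
    exact hq z hz.2
  exact convexHull_min hsub (convex_halfSpace_re_lt 0)
    (Polynomial.rootSet_derivative_subset_convexHull_rootSet hdeg hmem)

/-- Reflecting a point of the right half-plane in the imaginary axis brings it closer to every point
of the left half-plane. -/
theorem norm_neg_conj_sub_lt {s r : ℂ} (hs : 0 < s.re) (hr : r.re < 0) :
    ‖-(starRingEnd ℂ) s - r‖ < ‖s - r‖ := by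
  rw [← sq_lt_sq₀ (norm_nonneg _) (norm_nonneg _), ← Complex.normSq_eq_norm_sq,
    ← Complex.normSq_eq_norm_sq, Complex.normSq_apply, Complex.normSq_apply]
  simp only [Complex.sub_re, Complex.neg_re, Complex.conj_re, Complex.sub_im, Complex.neg_im,
    Complex.conj_im, neg_neg]
  nlinarith [mul_pos hs (neg_pos.mpr hr)]

theorem multiset_norm_prod_map_lt {R : Multiset ℂ} (hR : R ≠ 0) {f g : ℂ → ℂ}
    (h : ∀ r ∈ R, ‖f r‖ < ‖g r‖) : ‖(R.map f).prod‖ < ‖(R.map g).prod‖ := by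
  induction R using Multiset.induction_on with
  | empty => exact absurd rfl hR
  | cons a R ih =>
    have ha := h a (Multiset.mem_cons_self a R)
    rw [Multiset.map_cons, Multiset.map_cons, Multiset.prod_cons, Multiset.prod_cons, norm_mul,
      norm_mul]
    by_cases h0 : R = 0
    · simpa [h0] using ha
    · exact mul_lt_mul'' ha (ih h0 fun r hr => h r (Multiset.mem_cons_of_mem hr))
        (norm_nonneg _) (norm_nonneg _)

/-- Real coefficients allow `-s` to be replaced by the reflected point `-conj s`; the linear factors
are then compared one by one. -/
theorem IsHurwitz.norm_aeval_neg_lt {q : Polynomial ℝ} (hq : IsHurwitz q) (hdeg : 0 < q.natDegree)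
    {s : ℂ} (hs : 0 < s.re) : ‖Polynomial.aeval (-s) q‖ < ‖Polynomial.aeval s q‖ := by
  set Q := q.map (algebraMap ℝ ℂ) with hQ
  have hQ0 : Q ≠ 0 := (Polynomial.map_ne_zero_iff (algebraMap ℝ ℂ).injective).mpr
    (Polynomial.ne_zero_of_natDegree_gt hdeg)
  have heval : ∀ z : ℂ, Polynomial.aeval z q = Q.leadingCoeff * (Q.roots.map (z - ·)).prod := by
    intro z
    rw [← (IsAlgClosed.splits Q).eval_eq_prod_roots, hQ, Polynomial.eval_map_algebraMap]
  have hroots : Q.roots ≠ 0 := by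
    rw [← Multiset.card_pos, ← (IsAlgClosed.splits Q).natDegree_eq_card_roots, hQ,
      Polynomial.natDegree_map]
    exact hdeg
  have hconj : ‖Polynomial.aeval (-s) q‖ = ‖Polynomial.aeval (-(starRingEnd ℂ) s) q‖ := by
    rw [← map_neg, Polynomial.aeval_conj, RCLike.norm_conj]
  rw [hconj, heval, heval, norm_mul, norm_mul]
  refine mul_lt_mul_of_pos_left (multiset_norm_prod_map_lt hroots fun r hr => ?_)
    (norm_pos_iff.mpr (Polynomial.leadingCoeff_ne_zero.mpr hQ0))
  refine norm_neg_conj_sub_lt hs (hq r ?_)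
  rw [Polynomial.mem_roots hQ0, Polynomial.IsRoot.def, hQ, Polynomial.eval_map_algebraMap] at hr
  exact hr

/-- The Taylor polynomial `∑_{i ≤ N} s^i / i!` of the exponential function. -/
noncomputable def expTaylor (N : ℕ) : Polynomial ℝ :=
  ∑ i ∈ Finset.range (N + 1), Polynomial.C (1 / (Nat.factorial i : ℝ)) * Polynomial.X ^ i

theorem expTaylor_coeff (N i : ℕ) :
    (expTaylor N).coeff i = if i < N + 1 then 1 / (Nat.factorial i : ℝ) else 0 := by
  rw [expTaylor, Polynomial.finsetSum_coeff]
  simp only [Polynomial.coeff_C_mul_X_pow, Finset.sum_ite_eq, Finset.mem_range]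

theorem expTaylor_ne_zero (N : ℕ) : expTaylor N ≠ 0 := by
  intro h
  have := expTaylor_coeff N 0
  simp [h] at this

theorem derivative_expTaylor_succ (N : ℕ) :
    Polynomial.derivative (expTaylor (N + 1)) = expTaylor N := by
  ext i
  rw [Polynomial.coeff_derivative, expTaylor_coeff, expTaylor_coeff]
  by_cases h : i < N + 1
  · rw [if_pos h, if_pos (by omega), Nat.factorial_succ]
    push_cast
    field_simp
  · rw [if_neg h, if_neg (by omega), zero_mul]

theorem IsHurwitz.expTaylor_of_le {M N : ℕ} (h : N ≤ M) (hM : IsHurwitz (expTaylor M)) :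
    IsHurwitz (expTaylor N) := by
  induction M, h using Nat.le_induction with
  | base => exact hM
  | succ M _ ih =>
    refine ih ?_
    have := hM.derivative (by rw [derivative_expTaylor_succ]; exact expTaylor_ne_zero M)
    rwa [derivative_expTaylor_succ] at this

theorem isHurwitz_expTaylor_four : IsHurwitz (expTaylor 4) := by
  intro s hs
  by_contra hcon
  have hs' : s ^ 4 + 4 * s ^ 3 + 12 * s ^ 2 + 24 * s + 24 = 0 := by
    have : Polynomial.aeval s (expTaylor 4) = 1 + s + s ^ 2 / 2 + s ^ 3 / 6 + s ^ 4 / 24 := by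
      simp [expTaylor, Finset.sum_range_succ, Nat.factorial]
      ring
    rw [this] at hs
    linear_combination 24 * hs
  obtain ⟨a, b⟩ := s
  simp only [not_lt] at hcon
  have hre := congrArg Complex.re hs'
  have him := congrArg Complex.im hs'
  simp [pow_succ] at hre him
  -- Either the root is real, which is impossible for `a ≥ 0`, or `b²` can be eliminated from the
  -- real part. After clearing `(a + 1)²`, the result is a polynomial in `a` all of whose
  -- coefficients are negative.
  have him' : b * ((a + 1) * b ^ 2 - (a ^ 3 + 3 * a ^ 2 + 6 * a + 6)) = 0 := by
    linear_combination (-1 / 4) * him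
  rcases mul_eq_zero.mp him' with hb | hb
  · subst hb
    have : 0 ≤ a ^ 4 + 4 * a ^ 3 + 12 * a ^ 2 + 24 * a := by positivity
    nlinarith
  · have key : (a + 1) ^ 2 * (a ^ 4 + 4 * a ^ 3 + 12 * a ^ 2 + 24 * a + 24) -
        (a ^ 3 + 3 * a ^ 2 + 6 * a + 6) * (a + 1) * (6 * a ^ 2 + 12 * a + 12) +
        (a ^ 3 + 3 * a ^ 2 + 6 * a + 6) ^ 2 = 0 := by
      linear_combination (a + 1) ^ 2 * hre + ((a + 1) * (6 * a ^ 2 + 12 * a + 12) -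
        ((a + 1) * b ^ 2 + (a ^ 3 + 3 * a ^ 2 + 6 * a + 6))) * hb
    have : 0 < -((a + 1) ^ 2 * (a ^ 4 + 4 * a ^ 3 + 12 * a ^ 2 + 24 * a + 24) -
        (a ^ 3 + 3 * a ^ 2 + 6 * a + 6) * (a + 1) * (6 * a ^ 2 + 12 * a + 12) +
        (a ^ 3 + 3 * a ^ 2 + 6 * a + 6) ^ 2) := by
      ring_nf
      positivity
    linarith

theorem not_isHurwitz_expTaylor_five : ¬ IsHurwitz (expTaylor 5) := by
  intro h
  have hdeg : 0 < (expTaylor 5).natDegree :=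
    lt_of_lt_of_le (by norm_num) (Polynomial.le_natDegree_of_ne_zero (n := 5)
      (by rw [expTaylor_coeff]; norm_num [Nat.factorial]))
  have heval : ∀ s : ℂ, Polynomial.aeval s (expTaylor 5) =
      1 + s + s ^ 2 / 2 + s ^ 3 / 6 + s ^ 4 / 24 + s ^ 5 / 120 := by
    intro s
    simp [expTaylor, Finset.sum_range_succ, Nat.factorial]
    ring
  -- The odd part of `e_5` is `s ((s² + 10)² + 20) / 120`; at its zeros the values at `s` and `-s`
  -- agree.
  have hne : ∀ s : ℂ, 0 < s.re → (s ^ 2 + 10) ^ 2 ≠ -20 := by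
    intro s hs hcon
    refine (h.norm_aeval_neg_lt hdeg hs).ne (congrArg norm ?_)
    rw [heval, heval]
    linear_combination (-s / 60) * hcon
  obtain ⟨w, hw⟩ := IsAlgClosed.exists_pow_nat_eq (-20 : ℂ) (n := 2) (by norm_num)
  obtain ⟨s, hs⟩ := IsAlgClosed.exists_pow_nat_eq (w - 10) (n := 2) (by norm_num)
  have hs' : (s ^ 2 + 10) ^ 2 = -20 := by rw [hs, sub_add_cancel, hw]
  -- The equation is even in `s`, so a solution off the imaginary axis may be moved to the right. On
  -- the axis `s²` is real, and a real square cannot equal `-20`.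
  rcases lt_trichotomy s.re 0 with hlt | heq | hgt
  · exact hne (-s) (by simpa using hlt) (by rw [neg_sq]; exact hs')
  · have hre := congrArg Complex.re hs'
    simp [pow_two, heq] at hre
    nlinarith [sq_nonneg (-(s.im * s.im) + 10)]
  · exact hne s hgt hs'

theorem isHurwitz_expTaylor_iff (N : ℕ) : IsHurwitz (expTaylor N) ↔ N ≤ 4 :=
  ⟨fun h => not_lt.mp fun hN => not_isHurwitz_expTaylor_five (h.expTaylor_of_le hN),
    fun h => isHurwitz_expTaylor_four.expTaylor_of_le h⟩

theorem aeval_slowPoly (k : ℕ) (T : ℝ) (s : ℂ) :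
    Polynomial.aeval s (slowPoly k T) = (((Nat.factorial (k + 1) : ℝ) / T ^ (k + 1) : ℝ) : ℂ) *
      Polynomial.aeval ((T : ℂ) * s) (expTaylor (k + 1)) := by
  rw [slowPoly, expTaylor, map_mul, map_sum, map_sum, Polynomial.aeval_C]
  congr 1
  refine Finset.sum_congr rfl fun i _ => ?_
  simp [mul_pow]
  ring

/-- The roots are those of `e_{k+1}` divided by `T > 0`, and this scaling preserves the half-plane.
The degree `k + 1` turns `N ≤ 4` into `k ≤ 3`. -/
theorem isHurwitz_slowPoly_iff (k : ℕ) {T : ℝ} (hT : 0 < T) :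
    IsHurwitz (slowPoly k T) ↔ k ≤ 3 := by
  have hd : (((Nat.factorial (k + 1) : ℝ) / T ^ (k + 1) : ℝ) : ℂ) ≠ 0 :=
    Complex.ofReal_ne_zero.mpr (by positivity)
  have h1 : IsHurwitz (slowPoly k T) ↔ IsHurwitz (expTaylor (k + 1)) := by
    constructor
    · intro h s hs
      have hTs : (T : ℂ) * (((T⁻¹ : ℝ) : ℂ) * s) = s := by
        rw [← mul_assoc, ← Complex.ofReal_mul, mul_inv_cancel₀ hT.ne', Complex.ofReal_one, one_mul]
      have := h (((T⁻¹ : ℝ) : ℂ) * s) (by rw [aeval_slowPoly, hTs, hs, mul_zero])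
      rw [Complex.re_ofReal_mul] at this
      exact neg_of_mul_neg_right this (inv_pos.mpr hT).le
    · intro h s hs
      rw [aeval_slowPoly, mul_eq_zero] at hs
      have := h _ (hs.resolve_left hd)
      rw [Complex.re_ofReal_mul] at this
      exact neg_of_mul_neg_right this hT.le
  rw [h1, isHurwitz_expTaylor_iff]
  omega

theorem isHurwitz_pow_iff {q : Polynomial ℝ} {m : ℕ} (hm : m ≠ 0) :
    IsHurwitz (q ^ m) ↔ IsHurwitz q := by
  simp only [IsHurwitz, map_pow, pow_eq_zero_iff hm]

end Hurwitz

/-! ### Estimates on a single chain, uniform in `α` -/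

section IntegratorChain

open Set

/-- Multiply by the integrating factor `e^{-lt}` and compare with a real function of matching
growth. The factor `1 / (-l.re)` later becomes the decisive `1 / α`. -/
theorem norm_le_of_firstOrder {w v : ℝ → ℂ} {l : ℂ} {b V : ℝ} (hl : l.re < 0)
    (hw : ∀ t, 0 ≤ t → HasDerivWithinAt w (l * w t + v t) (Ici 0) t)
    (hv : ∀ t ∈ Icc 0 b, ‖v t‖ ≤ V) :
    ∀ t ∈ Icc 0 b, ‖w t‖ ≤ ‖w 0‖ + V / (-l.re) := by
  intro t ht
  have hV : 0 ≤ V := (norm_nonneg _).trans (hv t ht)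
  have hμ : 0 < -l.re := neg_pos.mpr hl
  have hexp : ∀ x : ℝ, HasDerivAt (fun x : ℝ => Complex.exp (-l * x))
      (Complex.exp (-l * x) * (-l)) x := by
    intro x
    have h1 : HasDerivAt (fun x : ℝ => -l * (x : ℂ)) (-l) x := by
      simpa using (Complex.ofRealCLM.hasDerivAt (x := x)).const_mul (-l)
    exact h1.cexp
  have hf : ∀ x : ℝ, 0 ≤ x → HasDerivWithinAt (fun x : ℝ => Complex.exp (-l * x) * w x)
      (Complex.exp (-l * x) * v x) (Ici 0) x := by
    intro x hx
    refine ((hexp x).hasDerivWithinAt.mul (hw x hx)).congr_deriv ?_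
    ring
  have hnorm : ∀ x : ℝ, ‖Complex.exp (-l * x)‖ = Real.exp (-l.re * x) := by
    intro x
    rw [Complex.norm_exp]
    simp
  have hB : ∀ x : ℝ, HasDerivAt (fun x => ‖w 0‖ + V / (-l.re) * (Real.exp (-l.re * x) - 1))
      (Real.exp (-l.re * x) * V) x := by
    intro x
    have h1 : HasDerivAt (fun x : ℝ => -l.re * x) (-l.re) x := by
      simpa using (hasDerivAt_id x).const_mul (-l.re)
    refine (((h1.exp.sub_const 1).const_mul (V / (-l.re))).const_add ‖w 0‖).congr_deriv ?_
    rw [mul_comm (Real.exp _), ← mul_assoc, div_mul_cancel₀ _ hμ.ne', mul_comm]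
  have key := image_norm_le_of_norm_deriv_right_le_deriv_boundary (a := 0) (b := b)
    (f := fun x : ℝ => Complex.exp (-l * x) * w x) (f' := fun x : ℝ => Complex.exp (-l * x) * v x)
    (fun x hx => (hf x hx.1).continuousWithinAt.mono (fun y hy => hy.1))
    (fun x hx => (hf x hx.1).mono (Ici_subset_Ici.mpr hx.1)) (by simp) hB
    (fun x hx => by
      rw [norm_mul, hnorm]
      exact mul_le_mul_of_nonneg_left (hv x ⟨hx.1, hx.2.le⟩) (Real.exp_pos _).le) ht
  simp only [norm_mul, hnorm] at key
  have h1 : 1 ≤ Real.exp (-l.re * t) := Real.one_le_exp (mul_nonneg hμ.le ht.1)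
  have h2 : 0 ≤ V / (-l.re) := div_nonneg hV hμ.le
  refine le_of_mul_le_mul_left (key.trans ?_) (Real.exp_pos (-l.re * t))
  nlinarith [mul_nonneg (sub_nonneg.mpr h1) (norm_nonneg (w 0))]

/-- `y 0, y 1, …, y (k + 1)` are successive derivatives on `[0, ∞)`. -/
def IsChain (k : ℕ) (y : ℕ → ℝ → ℂ) : Prop :=
  ∀ i ≤ k, ∀ t, 0 ≤ t → HasDerivWithinAt (y i) (y (i + 1) t) (Ici 0) t

/-- The value of the differential operator `q (d/dt)` on the chain `y`. -/
noncomputable def chainEval (k : ℕ) (q : Polynomial ℂ) (y : ℕ → ℝ → ℂ) (t : ℝ) : ℂ :=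
  ∑ i ∈ Finset.range (k + 2), q.coeff i * y i t

variable {k : ℕ}

theorem chainEval_add (p q : Polynomial ℂ) (y : ℕ → ℝ → ℂ) (t : ℝ) :
    chainEval k (p + q) y t = chainEval k p y t + chainEval k q y t := by
  simp only [chainEval, Polynomial.coeff_add, add_mul, Finset.sum_add_distrib]

theorem chainEval_C_mul (c : ℂ) (q : Polynomial ℂ) (y : ℕ → ℝ → ℂ) (t : ℝ) :
    chainEval k (Polynomial.C c * q) y t = c * chainEval k q y t := by
  simp only [chainEval, Polynomial.coeff_C_mul, mul_assoc, Finset.mul_sum]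

theorem chainEval_X_mul (q : Polynomial ℂ) (y : ℕ → ℝ → ℂ) (t : ℝ) :
    chainEval k (Polynomial.X * q) y t =
      ∑ i ∈ Finset.range (k + 1), q.coeff i * y (i + 1) t := by
  rw [chainEval, Finset.sum_range_succ']
  simp

theorem norm_chainEval_zero_le {y : ℕ → ℝ → ℂ} {N : ℝ} (hN : ∀ i ≤ k + 1, ‖y i 0‖ ≤ N)
    (q : Polynomial ℂ) :
    ‖chainEval k q y 0‖ ≤ (∑ i ∈ Finset.range (k + 2), ‖q.coeff i‖) * N := by
  rw [chainEval, Finset.sum_mul]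
  refine norm_sum_le_of_le _ fun i hi => ?_
  rw [norm_mul]
  exact mul_le_mul_of_nonneg_left (hN i (Nat.lt_succ_iff.mp (Finset.mem_range.mp hi)))
    (norm_nonneg _)

theorem IsChain.hasDerivWithinAt_sum {y : ℕ → ℝ → ℂ} (hy : IsChain k y) (q : Polynomial ℂ) {t : ℝ}
    (ht : 0 ≤ t) :
    HasDerivWithinAt (fun t => ∑ i ∈ Finset.range (k + 1), q.coeff i * y i t)
      (chainEval k (Polynomial.X * q) y t) (Ici 0) t := by
  rw [chainEval_X_mul]
  exact HasDerivWithinAt.fun_sum fun i hi =>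
    (hy i (Nat.lt_succ_iff.mp (Finset.mem_range.mp hi)) t ht).const_mul _

/-- Along every chain, `h (d/dt)` is bounded by `f (d/dt)` and the initial values. -/
def IsDominated (k : ℕ) (f h : Polynomial ℂ) : Prop :=
  ∃ C : ℝ, 0 ≤ C ∧ ∀ y, IsChain k y → ∀ b N E : ℝ, (∀ i ≤ k + 1, ‖y i 0‖ ≤ N) →
    (∀ t ∈ Icc 0 b, ‖chainEval k f y t‖ ≤ E) →
    ∀ t ∈ Icc 0 b, ‖chainEval k h y t‖ ≤ C * (N + E)

variable {f : Polynomial ℂ}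

theorem IsDominated.refl (k : ℕ) (f : Polynomial ℂ) : IsDominated k f f := by
  refine ⟨1, zero_le_one, fun y _ b N E hN hE t ht => ?_⟩
  have := (norm_nonneg _).trans (hN 0 (Nat.zero_le _))
  linarith [hE t ht]

theorem IsDominated.zero (k : ℕ) (f : Polynomial ℂ) : IsDominated k f 0 :=
  ⟨0, le_rfl, fun y _ b N E _ _ t _ => by simp [chainEval]⟩

theorem IsDominated.add {p q : Polynomial ℂ} (hp : IsDominated k f p) (hq : IsDominated k f q) :
    IsDominated k f (p + q) := by
  obtain ⟨C, hC, hp⟩ := hp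
  obtain ⟨D, hD, hq⟩ := hq
  refine ⟨C + D, add_nonneg hC hD, fun y hy b N E hN hE t ht => ?_⟩
  rw [chainEval_add, add_mul]
  exact norm_add_le_of_le (hp y hy b N E hN hE t ht) (hq y hy b N E hN hE t ht)

theorem IsDominated.C_mul {q : Polynomial ℂ} (hq : IsDominated k f q) (c : ℂ) :
    IsDominated k f (Polynomial.C c * q) := by
  obtain ⟨D, hD, hq⟩ := hq
  refine ⟨‖c‖ * D, by positivity, fun y hy b N E hN hE t ht => ?_⟩
  rw [chainEval_C_mul, norm_mul, mul_assoc]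
  exact mul_le_mul_of_nonneg_left (hq y hy b N E hN hE t ht) (norm_nonneg _)

/-- The signal `h(d/dt) y` solves a stable first-order equation driven by `((X - l) h)(d/dt) y`. The
degree bound keeps its derivative within the chain. -/
theorem IsDominated.of_X_sub_C_mul {h : Polynomial ℂ} {l : ℂ} (hl : l.re < 0)
    (hdeg : h.natDegree ≤ k) (hd : IsDominated k f ((Polynomial.X - Polynomial.C l) * h)) :
    IsDominated k f h := by
  obtain ⟨C, hC, hd⟩ := hd
  have hμ : 0 < -l.re := neg_pos.mpr hl
  set S := ∑ i ∈ Finset.range (k + 2), ‖h.coeff i‖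
  have hS : 0 ≤ S := Finset.sum_nonneg fun i _ => norm_nonneg _
  refine ⟨S + C / (-l.re), by positivity, fun y hy b N E hN hE t ht => ?_⟩
  have hN0 : 0 ≤ N := (norm_nonneg _).trans (hN 0 (Nat.zero_le _))
  have hE0 : 0 ≤ E := (norm_nonneg _).trans (hE t ht)
  have hsum : ∀ t, chainEval k h y t = ∑ i ∈ Finset.range (k + 1), h.coeff i * y i t := by
    intro t
    rw [chainEval, Finset.sum_range_succ,
      Polynomial.coeff_eq_zero_of_natDegree_lt (Nat.lt_succ_of_le hdeg), zero_mul, add_zero]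
  have hderiv : ∀ t, 0 ≤ t → HasDerivWithinAt (chainEval k h y)
      (l * chainEval k h y t + chainEval k ((Polynomial.X - Polynomial.C l) * h) y t)
      (Ici 0) t := by
    intro t ht
    rw [funext hsum]
    refine (hy.hasDerivWithinAt_sum h ht).congr_deriv ?_
    simp only [← hsum]
    rw [sub_mul, sub_eq_add_neg, chainEval_add, ← neg_mul, ← Polynomial.C_neg,
      chainEval_C_mul]
    ring
  have := norm_le_of_firstOrder hl hderiv (hd y hy b N E hN hE) t ht
  have h0 := norm_chainEval_zero_le hN h
  have h1 : C * (N + E) / (-l.re) = C / (-l.re) * (N + E) := by ring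
  rw [h1] at this
  nlinarith [mul_nonneg hS hE0]

theorem natDegree_list_prod_X_sub_C (L : List ℂ) :
    (L.map fun a => Polynomial.X - Polynomial.C a).prod.natDegree = L.length := by
  have := Polynomial.natDegree_multiset_prod_X_sub_C_eq_card (L : Multiset ℂ)
  simpa using this

theorem monic_list_prod_X_sub_C (L : List ℂ) :
    (L.map fun a => Polynomial.X - Polynomial.C a).prod.Monic := by
  have := Polynomial.monic_multisetProd_X_sub_C (L : Multiset ℂ)
  simpa using this

/-- The stable factors in `L` are divided out of `f` one at a time. -/
theorem IsDominated.list_prod (L M : List ℂ) (hlen : L.length + M.length = k + 1)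
    (hL : ∀ a ∈ L, a.re < 0)
    (hf : f = (L.map fun a => Polynomial.X - Polynomial.C a).prod *
      (M.map fun a => Polynomial.X - Polynomial.C a).prod) :
    IsDominated k f (M.map fun a => Polynomial.X - Polynomial.C a).prod := by
  induction L generalizing M with
  | nil =>
    rw [hf, List.map_nil, List.prod_nil, one_mul]
    exact IsDominated.refl _ _
  | cons a L ih =>
    rw [List.length_cons] at hlen
    refine IsDominated.of_X_sub_C_mul (hL a List.mem_cons_self)
      (by rw [natDegree_list_prod_X_sub_C]; omega) ?_
    have := ih (a :: M) (by rw [List.length_cons]; omega)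
      (fun b hb => hL b (List.mem_cons_of_mem a hb)) (by
        rw [hf, List.map_cons, List.map_cons, List.prod_cons, List.prod_cons]
        ring)
    rwa [List.map_cons, List.prod_cons] at this

/-- The partial products of the linear factors of `f` provide one dominated monic polynomial in each
degree up to `k + 1`. Subtracting a multiple of the one in degree `j` lowers the degree of `p`. -/
theorem isDominated_of_degree_lt (hmonic : f.Monic) (hdeg : f.natDegree = k + 1)
    (hroots : ∀ s, f.IsRoot s → s.re < 0) (j : ℕ) (hj : j ≤ k + 2) (p : Polynomial ℂ)
    (hp : p.degree < j) : IsDominated k f p := by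
  induction j generalizing p with
  | zero =>
    rw [Polynomial.degree_lt_iff_coeff_zero] at hp
    have : p = 0 := by
      ext n
      simpa using hp n (Nat.zero_le n)
    rw [this]
    exact IsDominated.zero k f
  | succ j ih =>
    obtain ⟨L, hL⟩ := Quot.exists_rep f.roots
    have hL' : f.roots = (L : Multiset ℂ) := hL.symm
    have hlen : L.length = k + 1 := by
      rw [← hdeg, (IsAlgClosed.splits f).natDegree_eq_card_roots, hL', Multiset.coe_card]
    have hfL : f = (L.map fun a => Polynomial.X - Polynomial.C a).prod := by
      have := (IsAlgClosed.splits f).eq_prod_roots_of_monic hmonic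
      rw [hL', Multiset.map_coe, Multiset.prod_coe] at this
      exact this
    have hre : ∀ a ∈ L, a.re < 0 := by
      intro a ha
      refine hroots a (Polynomial.isRoot_of_mem_roots ?_)
      rw [hL']
      exact ha
    set q := ((L.take j).map fun a => Polynomial.X - Polynomial.C a).prod with hq
    have hqd : q.natDegree = j := by
      rw [hq, natDegree_list_prod_X_sub_C, List.length_take]
      omega
    have hqm : q.Monic := monic_list_prod_X_sub_C _
    have hdom : IsDominated k f q := by
      refine IsDominated.list_prod (L.drop j) (L.take j) (by simp; omega)
        (fun a ha => hre a (List.mem_of_mem_drop ha)) ?_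
      rw [mul_comm, ← List.prod_append, ← List.map_append, List.take_append_drop]
      exact hfL
    have hrest : IsDominated k f (p + Polynomial.C (-p.coeff j) * q) := by
      refine ih (by omega) _ ?_
      rw [Polynomial.degree_lt_iff_coeff_zero] at hp ⊢
      intro n hn
      rw [Polynomial.coeff_add, Polynomial.coeff_C_mul]
      rcases hn.eq_or_lt with rfl | hlt
      · have : q.coeff j = 1 := by
          have := hqm.coeff_natDegree
          rwa [hqd] at this
        rw [this]
        ring
      · rw [hp n hlt, Polynomial.coeff_eq_zero_of_natDegree_lt (p := q) (by omega)]
        ring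
    have := hrest.add (hdom.C_mul (p.coeff j))
    rwa [add_assoc, ← add_mul, ← Polynomial.C_add, neg_add_cancel, Polynomial.C_0, zero_mul,
      add_zero] at this

/-- A small-gain argument for `w = f(d/dt) y`: the perturbation of its fast equation is bounded by
`w` itself, but enters with gain of order `1 / α`. -/
theorem exists_chain_bound (hmonic : f.Monic) (hdeg : f.natDegree = k + 1)
    (hroots : ∀ s, f.IsRoot s → s.re < 0) :
    ∃ αbar K : ℝ, 0 < αbar ∧ 0 ≤ K ∧ ∀ α, αbar < α → ∀ (y : ℕ → ℝ → ℂ) (ρ : ℝ → ℂ) (N R : ℝ),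
      IsChain k y →
      (∀ t, 0 ≤ t → HasDerivWithinAt (y (k + 1)) (α * (ρ t - chainEval k f y t)) (Ici 0) t) →
      (∀ i ≤ k + 1, ‖y i 0‖ ≤ N) → (∀ t, 0 ≤ t → ‖ρ t‖ ≤ R) →
      ∀ t, 0 ≤ t → ∀ i ≤ k + 1, ‖y i t‖ ≤ K * (N + R) := by
  set p : Polynomial ℂ := f - Polynomial.X ^ (k + 1) with hp
  have hf1 : f.coeff (k + 1) = 1 := by
    have := hmonic.coeff_natDegree
    rwa [hdeg] at this
  -- Removing the leading term of `f` leaves the derivative of `y (k + 1)`, and with it `α`, out of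
  -- the perturbation.
  have hpX : (Polynomial.X * p).degree < ((k + 2 : ℕ) : WithBot ℕ) := by
    rw [Polynomial.degree_lt_iff_coeff_zero]
    rintro (_ | n) hn
    · omega
    · rw [Polynomial.coeff_X_mul, hp, Polynomial.coeff_sub, Polynomial.coeff_X_pow]
      rcases (show k + 1 ≤ n by omega).eq_or_lt with rfl | hlt
      · rw [hf1, if_pos rfl, sub_self]
      · rw [Polynomial.coeff_eq_zero_of_natDegree_lt (by omega), if_neg (by omega), sub_zero]
  obtain ⟨C, hC, hCb⟩ := isDominated_of_degree_lt hmonic hdeg hroots (k + 2) le_rfl _ hpX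
  have hXi : ∀ i : ℕ, ∃ D : ℝ, 0 ≤ D ∧ (i ≤ k + 1 → ∀ y, IsChain k y → ∀ b N E : ℝ,
      (∀ i ≤ k + 1, ‖y i 0‖ ≤ N) → (∀ t ∈ Icc 0 b, ‖chainEval k f y t‖ ≤ E) →
      ∀ t ∈ Icc 0 b, ‖y i t‖ ≤ D * (N + E)) := by
    intro i
    by_cases hi : i ≤ k + 1
    · obtain ⟨D, hD, h⟩ := isDominated_of_degree_lt hmonic hdeg hroots (k + 2) le_rfl
        (Polynomial.X ^ i) (by
          rw [Polynomial.degree_X_pow]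
          exact_mod_cast Nat.lt_succ_of_le hi)
      refine ⟨D, hD, fun _ y hy b N E hN hE t ht => ?_⟩
      have := h y hy b N E hN hE t ht
      rw [chainEval, Finset.sum_eq_single i] at this
      · simpa using this
      · intro j _ hj
        rw [Polynomial.coeff_X_pow, if_neg hj, zero_mul]
      · intro h
        simp only [Finset.mem_range] at h
        omega
    · exact ⟨0, le_rfl, fun h => absurd h hi⟩
  choose D hD hDb using hXi
  set F := ∑ i ∈ Finset.range (k + 2), ‖f.coeff i‖
  have hF : 0 ≤ F := Finset.sum_nonneg fun i _ => norm_nonneg _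
  set K := ∑ i ∈ Finset.range (k + 2), D i
  have hK : 0 ≤ K := Finset.sum_nonneg fun i _ => hD i
  -- With `α > 2C + 1` the term `C E / α` is at most `E / 2`, and `C N / α` at most `C N`. Solving
  -- for `E` gives `E ≤ 2(F + C)N + 2R`, whence the second constant.
  refine ⟨2 * C + 1, K * (2 * (F + C) + 2), by positivity, by positivity, ?_⟩
  intro α hα y ρ N R hy hν hN hρ t ht i hi
  have hα0 : 0 < α := by linarith
  have hN0 : 0 ≤ N := (norm_nonneg _).trans (hN 0 (Nat.zero_le _))
  have hR0 : 0 ≤ R := (norm_nonneg _).trans (hρ 0 le_rfl)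
  have hw : ∀ t, 0 ≤ t → HasDerivWithinAt (chainEval k f y)
      (((-α : ℝ) : ℂ) * chainEval k f y t + (chainEval k (Polynomial.X * p) y t + α * ρ t))
      (Ici 0) t := by
    intro t ht
    have hsum : ∀ t, chainEval k f y t =
        ∑ i ∈ Finset.range (k + 1), p.coeff i * y i t + y (k + 1) t := by
      intro t
      rw [chainEval, Finset.sum_range_succ, hf1, one_mul]
      congr 1
      refine Finset.sum_congr rfl fun i hi => ?_
      rw [hp, Polynomial.coeff_sub, Polynomial.coeff_X_pow,
        if_neg (Finset.mem_range.mp hi).ne, sub_zero]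
    have h := (hy.hasDerivWithinAt_sum p ht).add (hν t ht)
    refine (h.congr (fun x _ => hsum x) (hsum t)).congr_deriv ?_
    push_cast
    ring
  -- The maximum on the compact interval gives a finite `E`, so it can be absorbed without an a
  -- priori bound on `[0, ∞)`.
  have hcont : ContinuousOn (fun s => ‖chainEval k f y s‖) (Icc 0 t) := fun x hx =>
    ((hw x hx.1).continuousWithinAt.mono fun z hz => hz.1).norm
  obtain ⟨x, hx, hmax⟩ := isCompact_Icc.exists_isMaxOn (nonempty_Icc.mpr ht) hcont
  set E := ‖chainEval k f y x‖ with hEdef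
  have hE : ∀ s ∈ Icc 0 t, ‖chainEval k f y s‖ ≤ E := fun s hs => hmax hs
  have hE0 : 0 ≤ E := norm_nonneg _
  have hv : ∀ s ∈ Icc 0 t, ‖chainEval k (Polynomial.X * p) y s + α * ρ s‖ ≤
      C * (N + E) + α * R := by
    intro s hs
    refine norm_add_le_of_le (hCb y hy t N E hN hE s hs) ?_
    rw [norm_mul, Complex.norm_real, Real.norm_of_nonneg hα0.le]
    exact mul_le_mul_of_nonneg_left (hρ s hs.1) hα0.le
  have hbound := norm_le_of_firstOrder (l := ((-α : ℝ) : ℂ)) (by simpa using hα0) hw hv x hx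
  rw [Complex.ofReal_re, neg_neg, ← hEdef] at hbound
  have h0 := norm_chainEval_zero_le hN f
  have hdiv : (C * (N + E) + α * R) / α ≤ C * N + E / 2 + R := by
    rw [div_le_iff₀ hα0]
    nlinarith [mul_nonneg hC hN0, mul_nonneg hE0 (sub_nonneg.mpr hα.le)]
  have hEle : E ≤ 2 * (F + C) * N + 2 * R := by linarith
  have hyi := hDb i hi y hy t N E hN hE t ⟨ht, le_rfl⟩
  have hDK : D i ≤ K := Finset.single_le_sum (fun i _ => hD i)
    (Finset.mem_range.mpr (Nat.lt_succ_of_le hi))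
  have h1 : D i * (N + E) ≤ K * (N + E) :=
    mul_le_mul_of_nonneg_right hDK (add_nonneg hN0 hE0)
  have h2 : K * (N + E) ≤ K * ((2 * (F + C) + 2) * (N + R)) := by
    refine mul_le_mul_of_nonneg_left ?_ hK
    nlinarith [mul_nonneg (add_nonneg hF hC) hR0]
  rw [mul_assoc]
  exact hyi.trans (h1.trans h2)

end IntegratorChain

/-! ### Existence and uniqueness for linear equations -/

section LinearODE

open Set

variable {E : Type*} [NormedAddCommGroup E] [NormedSpace ℝ E] [CompleteSpace E]

theorem exp_smul_mul_exp_neg_smul (M : E →L[ℝ] E) (t : ℝ) :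
    NormedSpace.exp (t • M) * NormedSpace.exp (t • (-M)) = 1 := by
  let _ : NormedAlgebra ℚ (E →L[ℝ] E) := NormedAlgebra.restrictScalars ℚ ℝ (E →L[ℝ] E)
  rw [smul_neg, ← NormedSpace.exp_add_of_commute (Commute.neg_right (Commute.refl _)),
    add_neg_cancel, NormedSpace.exp_zero]

/-- Variation of constants. -/
theorem exists_linearODE_solution (M : E →L[ℝ] E) {b : ℝ → E} (hb : Continuous b) (z₀ : E) :
    ∃ z : ℝ → E, z 0 = z₀ ∧ ∀ t, HasDerivAt z (M (z t) + b t) t := by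
  have hexp : Continuous fun s : ℝ => NormedSpace.exp (s • (-M)) :=
    continuous_iff_continuousAt.mpr fun s => (hasDerivAt_exp_smul_const (-M) s).continuousAt
  refine ⟨fun t => NormedSpace.exp (t • M)
    (z₀ + ∫ s in (0 : ℝ)..t, NormedSpace.exp (s • (-M)) (b s)), by simp, fun t => ?_⟩
  have h1 := hasDerivAt_exp_smul_const' M t
  have h2 := ((hexp.clm_apply hb).integral_hasStrictDerivAt 0 t).hasDerivAt.const_add z₀
  refine (h1.clm_apply h2).congr_deriv ?_
  rw [← mul_apply_eq_comp (NormedSpace.exp (t • M)), exp_smul_mul_exp_neg_smul]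
  simp

/-- The continuous function `e^{-tM} u(t)` has zero derivative off a countable set, so the
fundamental theorem of calculus with countable exceptions makes it constant. -/
theorem linearODE_eq_zero_of_off_countable (M : E →L[ℝ] E) {u : ℝ → E} {S : Set ℝ}
    (hS : (S ∩ Ici 0).Countable) (hu : ContinuousOn u (Ici 0)) (h0 : u 0 = 0)
    (hderiv : ∀ t ∈ Ici (0 : ℝ) \ S, HasDerivWithinAt u (M (u t)) (Ici 0) t) :
    ∀ t, 0 ≤ t → u t = 0 := by
  intro t ht
  have hexp : Continuous fun s : ℝ => NormedSpace.exp (s • (-M)) :=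
    continuous_iff_continuousAt.mpr fun s => (hasDerivAt_exp_smul_const (-M) s).continuousAt
  have key := MeasureTheory.integral_eq_of_hasDerivAt_off_countable_of_le
    (fun s => NormedSpace.exp (s • (-M)) (u s)) (fun _ => 0) ht hS
    (hexp.continuousOn.clm_apply (hu.mono fun x hx => hx.1))
    (fun x hx => by
      have hx0 : 0 < x := hx.1.1
      have h1 := (hderiv x ⟨hx0.le, fun h => hx.2 ⟨h, hx0.le⟩⟩).hasDerivAt (Ici_mem_nhds hx0)
      refine ((hasDerivAt_exp_smul_const (-M) x).clm_apply h1).congr_deriv ?_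
      simp) (by simp)
  simp only [intervalIntegral.integral_zero, h0, map_zero, sub_zero] at key
  have h := congrArg (fun x : E => (NormedSpace.exp (t • M)) x) key
  rw [← mul_apply_eq_comp, exp_smul_mul_exp_neg_smul] at h
  simpa using h.symm

end LinearODE

/-! ### Pointwise and essential bounds of signals -/

section Signals

open Set MeasureTheory

/-- By continuity a violation at one point would persist on a neighbourhood, which has positive
measure. Positive times suffice, since the loop only sees `r (t + T)`. -/
theorem norm_le_eLpNorm_of_continuousOn {E : Type*} [NormedAddCommGroup E] {r : ℝ → E}
    (hr : MemLp r ∞ timeMeasure) (hc : ContinuousOn r (Ici 0)) {t : ℝ} (ht : 0 < t) :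
    ‖r t‖ ≤ ‖hr.toLp r‖ := by
  by_contra hcon
  rw [not_le] at hcon
  have hae : ∀ᵐ s ∂(volume.restrict (Ici (0 : ℝ))), ‖r s‖ ≤ ‖hr.toLp r‖ := by
    have h : ∀ᵐ s ∂timeMeasure, ‖r s‖ₑ ≤ eLpNorm r ∞ timeMeasure := by
      rw [eLpNorm_exponent_top]
      exact ae_le_eLpNormEssSup
    filter_upwards [h] with s hs
    rw [Lp.norm_toLp, ← toReal_enorm]
    exact ENNReal.toReal_mono hr.2.ne hs
  rw [ae_restrict_iff' measurableSet_Ici] at hae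
  have hev : ∀ᶠ s in nhds t, ‖hr.toLp r‖ < ‖r s‖ ∧ 0 < s :=
    (((hc.continuousAt (Ici_mem_nhds ht)).norm).eventually_const_lt hcon).and (lt_mem_nhds ht)
  have hpos : volume {s | ‖hr.toLp r‖ < ‖r s‖ ∧ 0 < s} ≠ 0 :=
    (Measure.measure_pos_of_mem_nhds volume hev).ne'
  refine hpos (measure_mono_null ?_ hae)
  rintro s ⟨h1, h2⟩ h3
  exact absurd (h3 h2.le) (not_le.mpr h1)

theorem euclidean_norm_le_card_mul {ι : Type*} [Fintype ι] (x : EuclideanSpace ℝ ι) {B : ℝ}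
    (hB : 0 ≤ B) (h : ∀ i, ‖x i‖ ≤ B) : ‖x‖ ≤ Fintype.card ι * B := by
  rw [EuclideanSpace.norm_eq]
  refine Real.sqrt_le_iff.mpr ⟨by positivity, ?_⟩
  have h1 : ∑ i, ‖x i‖ ^ 2 ≤ ∑ _i : ι, B ^ 2 :=
    Finset.sum_le_sum fun i _ => pow_le_pow_left₀ (norm_nonneg _) (h i) 2
  rw [Finset.sum_const, Finset.card_univ, nsmul_eq_mul] at h1
  have h2 : (Fintype.card ι : ℝ) ≤ (Fintype.card ι : ℝ) ^ 2 := by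
    exact_mod_cast Nat.le_self_pow two_ne_zero _
  rw [mul_pow]
  exact h1.trans (mul_le_mul_of_nonneg_right h2 (sq_nonneg B))

theorem hasDerivWithinAt_euclidean_apply {ι : Type*} [Fintype ι] {z : ℝ → EuclideanSpace ℝ ι}
    {z' : EuclideanSpace ℝ ι} {s : Set ℝ} {t : ℝ} (h : HasDerivWithinAt z z' s t) (i : ι) :
    HasDerivWithinAt (fun t => z t i) (z' i) s t :=
  (EuclideanSpace.proj (𝕜 := ℝ) i).hasFDerivAt.comp_hasDerivWithinAt t h

end Signals

/-! ### The predictor and the closed-loop field -/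

section Predictor

open Set

variable {m k : ℕ}

/-- The component `a` of `y^(i)`, where `y^(k+1)` is the input. -/
noncomputable def chainCoord (z : EuclideanSpace ℝ ((Fin (k + 1) × Fin m) ⊕ Fin m)) (a : Fin m)
    (i : ℕ) : ℝ :=
  if h : i < k + 1 then z (Sum.inl (⟨i, h⟩, a)) else z (Sum.inr a)

theorem chainCoord_of_lt (z : EuclideanSpace ℝ ((Fin (k + 1) × Fin m) ⊕ Fin m)) (a : Fin m)
    {i : ℕ} (h : i < k + 1) : chainCoord z a i = z (Sum.inl (⟨i, h⟩, a)) := dif_pos h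

theorem chainCoord_top (z : EuclideanSpace ℝ ((Fin (k + 1) × Fin m) ⊕ Fin m)) (a : Fin m) :
    chainCoord z a (k + 1) = z (Sum.inr a) := dif_neg (lt_irrefl _)

theorem abs_chainCoord_le (z : EuclideanSpace ℝ ((Fin (k + 1) × Fin m) ⊕ Fin m)) (a : Fin m)
    (i : ℕ) : ‖chainCoord z a i‖ ≤ ‖z‖ := by
  unfold chainCoord
  split_ifs <;> exact PiLp.norm_apply_le z _

theorem augment_statePart_inputPart {n p : Type*} [Fintype n] [Fintype p]
    (z : EuclideanSpace ℝ (n ⊕ p)) : augment (statePart z) (inputPart z) = z := by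
  ext (i | j) <;> rfl

theorem chain_linearField_apply (x : EuclideanSpace ℝ (Fin (k + 1) × Fin m))
    (u : EuclideanSpace ℝ (Fin m)) (i : Fin (k + 1)) (a : Fin m) :
    linearField (chainA m k) (chainB m k) x u (i, a) =
      chainCoord (augment x u) a ((i : ℕ) + 1) := by
  simp only [linearField, Pi.add_apply, Matrix.mulVec, dotProduct]
  by_cases h : (i : ℕ) + 1 < k + 1
  · have h2 : ¬ (i = Fin.last k) := fun h' => by simp [h'] at h
    rw [chainCoord_of_lt _ _ h, Finset.sum_eq_single (⟨(i : ℕ) + 1, h⟩, a)]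
    · simp [chainA, chainB, h2, augment]
    · rintro ⟨l, c⟩ - hne
      have : ¬ ((l : ℕ) = (i : ℕ) + 1 ∧ a = c) := fun h' =>
        hne (Prod.ext (Fin.ext h'.1) h'.2.symm)
      simp [chainA, this]
    · simp
  · have h2 : i = Fin.last k := by
      ext
      have := i.isLt
      rw [Fin.val_last]
      omega
    have h3 : (i : ℕ) + 1 = k + 1 := by rw [h2, Fin.val_last]
    rw [h3, chainCoord_top, Finset.sum_eq_zero, Finset.sum_eq_single a]
    · simp [chainB, h2, augment]
    · intro b _ hb
      simp [chainB, hb.symm]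
    · simp
    · rintro ⟨l, c⟩ -
      have := l.isLt
      have : ¬ ((l : ℕ) = (i : ℕ) + 1 ∧ a = c) := fun h' => by omega
      simp [chainA, this]

/-- The output predictor of `m` chains of `k + 1` integrators, the Taylor polynomial of `y`. -/
noncomputable def chainPredictor (m k : ℕ) (T : ℝ) (x : EuclideanSpace ℝ (Fin (k + 1) × Fin m))
    (u : EuclideanSpace ℝ (Fin m)) : EuclideanSpace ℝ (Fin m) :=
  WithLp.toLp 2 fun a => ∑ i ∈ Finset.range (k + 2),
    T ^ i / (Nat.factorial i : ℝ) * chainCoord (augment x u) a i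

theorem hasDerivAt_sub_pow_succ_div_factorial (T τ : ℝ) (i : ℕ) :
    HasDerivAt (fun τ : ℝ => (T - τ) ^ (i + 1) / (Nat.factorial (i + 1) : ℝ))
      (-((T - τ) ^ i / (Nat.factorial i : ℝ))) τ := by
  refine ((((hasDerivAt_id τ).const_sub T).pow (i + 1)).div_const _).congr_deriv ?_
  rw [Nat.factorial_succ]
  push_cast
  simp only [id]
  field_simp

/-- The Taylor prediction of `y(T)` made at time `τ` is constant along a frozen-input trajectory: it
is the predictor at `τ = 0` and the output at `τ = T`. No uniqueness theorem for the plant is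
needed. -/
theorem chainPredictor_eq_of_isFrozenInputSolution {T : ℝ} (hT : 0 < T)
    {x : EuclideanSpace ℝ (Fin (k + 1) × Fin m)} {u : EuclideanSpace ℝ (Fin m)}
    {ζ : ℝ → EuclideanSpace ℝ (Fin (k + 1) × Fin m)}
    (hζ : IsFrozenInputSolution (linearField (chainA m k) (chainB m k)) T x u ζ) :
    chainPredictor m k T x u = linearOutput (chainC m k) (ζ T) := by
  obtain ⟨h0, hd⟩ := hζ
  ext a
  have hY : ∀ i < k + 1, ∀ τ ∈ Icc 0 T, HasDerivWithinAt
      (fun τ => chainCoord (augment (ζ τ) u) a i) (chainCoord (augment (ζ τ) u) a (i + 1))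
      (Icc 0 T) τ := by
    intro i hi τ hτ
    have := hasDerivWithinAt_euclidean_apply (hd τ hτ) (⟨i, hi⟩, a)
    rw [chain_linearField_apply] at this
    simp only [chainCoord_of_lt _ _ hi]
    exact this
  set φ : ℝ → ℝ := fun τ => ∑ i ∈ Finset.range (k + 1),
    (T - τ) ^ i / (Nat.factorial i : ℝ) * chainCoord (augment (ζ τ) u) a i +
      (T - τ) ^ (k + 1) / (Nat.factorial (k + 1) : ℝ) * u a with hφ
  have hφd : ∀ τ ∈ Icc 0 T, HasDerivWithinAt φ 0 (Icc 0 T) τ := by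
    intro τ hτ
    have hterm : ∀ i ∈ Finset.range (k + 1), HasDerivWithinAt
        (fun τ => (T - τ) ^ i / (Nat.factorial i : ℝ) * chainCoord (augment (ζ τ) u) a i)
        ((if i = 0 then 0 else -((T - τ) ^ (i - 1) / (Nat.factorial (i - 1) : ℝ)) *
          chainCoord (augment (ζ τ) u) a i) +
        (T - τ) ^ i / (Nat.factorial i : ℝ) * chainCoord (augment (ζ τ) u) a (i + 1))
        (Icc 0 T) τ := by
      intro i hi
      have hYi := hY i (Finset.mem_range.mp hi) τ hτ
      rcases i with _ | i
      · simpa using hYi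
      · rw [if_neg (Nat.succ_ne_zero i), Nat.add_sub_cancel]
        exact (hasDerivAt_sub_pow_succ_div_factorial T τ i).hasDerivWithinAt.fun_mul hYi
    refine ((HasDerivWithinAt.fun_sum hterm).add
      ((hasDerivAt_sub_pow_succ_div_factorial T τ k).hasDerivWithinAt.mul_const (u a))).congr_deriv
        ?_
    -- Splitting off the first term of one sum and the last of the other aligns the indices, and the
    -- derivative telescopes to zero.
    rw [Finset.sum_add_distrib, Finset.sum_range_succ', Finset.sum_range_succ _ k, chainCoord_top]
    have : augment (ζ τ) u (Sum.inr a) = u a := rfl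
    rw [this]
    simp only [Nat.add_eq_zero_iff, one_ne_zero, and_false, if_false, if_true,
      Nat.add_sub_cancel, neg_mul, Finset.sum_neg_distrib]
    ring
  have hconst := constant_of_has_deriv_right_zero (f := φ) (a := 0) (b := T)
    (fun τ hτ => (hφd τ hτ).continuousWithinAt)
    (fun τ hτ => (hφd τ ⟨hτ.1, hτ.2.le⟩).mono_of_mem_nhdsWithin (Icc_mem_nhdsGE_of_mem hτ)) T
    ⟨hT.le, le_rfl⟩
  have hleft : chainPredictor m k T x u a = φ 0 := by
    simp only [chainPredictor, hφ, h0, sub_zero]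
    rw [Finset.sum_range_succ, chainCoord_top]
    rfl
  have hright : linearOutput (chainC m k) (ζ T) a = φ T := by
    simp only [hφ, sub_self, linearOutput, Matrix.mulVec, dotProduct]
    rw [Finset.sum_range_succ', Finset.sum_eq_zero (s := Finset.range k),
      Finset.sum_eq_single (0, a), chainCoord_of_lt _ _ (Nat.succ_pos k)]
    · simp [chainC, augment]
    · rintro ⟨l, c⟩ - hne
      have : ¬ (l = 0 ∧ a = c) := fun h => hne (Prod.ext h.1 h.2.symm)
      simp [chainC, this]
    · simp
    · intro i _
      simp
  rw [hleft, hright, hconst]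

theorem isPredictor_chainPredictor (m k : ℕ) {T : ℝ} (hT : 0 < T) :
    IsPredictor (linearField (chainA m k) (chainB m k)) (linearOutput (chainC m k)) T
      (chainPredictor m k T) := by
  intro x u
  refine ⟨?_, fun ζ hζ => chainPredictor_eq_of_isFrozenInputSolution hT hζ⟩
  obtain ⟨ζ, h0, hζ⟩ := exists_linearODE_solution (Matrix.toEuclideanCLM (𝕜 := ℝ) (chainA m k))
    (b := fun _ => WithLp.toLp 2 ((chainB m k).mulVec u)) continuous_const x
  refine ⟨ζ, h0, fun τ _ => ((hζ τ).congr_deriv ?_).hasDerivWithinAt⟩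
  ext i
  simp [linearField, Matrix.ofLp_toEuclideanCLM]

/-- The predictor is affine in the input, which enters only through the last Taylor term. -/
theorem hasFDerivAt_chainPredictor (T : ℝ) (x : EuclideanSpace ℝ (Fin (k + 1) × Fin m))
    (u : EuclideanSpace ℝ (Fin m)) :
    HasFDerivAt (fun v => chainPredictor m k T x v)
      ((T ^ (k + 1) / (Nat.factorial (k + 1) : ℝ)) •
        ContinuousLinearMap.id ℝ (EuclideanSpace ℝ (Fin m))) u := by
  have h : (fun v => chainPredictor m k T x v) = fun v =>
      chainPredictor m k T x 0 + (T ^ (k + 1) / (Nat.factorial (k + 1) : ℝ)) • v := by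
    funext v
    ext a
    simp only [chainPredictor, PiLp.add_apply, PiLp.smul_apply, smul_eq_mul]
    rw [Finset.sum_range_succ _ (k + 1), Finset.sum_range_succ _ (k + 1), chainCoord_top,
      chainCoord_top]
    have : ∀ i ∈ Finset.range (k + 1), chainCoord (augment x v) a i =
        chainCoord (augment x (0 : EuclideanSpace ℝ (Fin m))) a i := by
      intro i hi
      rw [chainCoord_of_lt _ _ (Finset.mem_range.mp hi),
        chainCoord_of_lt _ _ (Finset.mem_range.mp hi)]
      rfl
    rw [Finset.sum_congr rfl fun i hi => by rw [this i hi]]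
    simp [augment]
  rw [h]
  exact ((hasFDerivAt_id u).fun_const_smul _).const_add _

theorem chainPredictor_inputJacobian (T : ℝ) (x : EuclideanSpace ℝ (Fin (k + 1) × Fin m))
    (u : EuclideanSpace ℝ (Fin m)) :
    inputJacobian (chainPredictor m k T) x u = (T ^ (k + 1) / (Nat.factorial (k + 1) : ℝ)) •
        ContinuousLinearMap.id ℝ (EuclideanSpace ℝ (Fin m)) :=
  (hasFDerivAt_chainPredictor T x u).fderiv

theorem smul_id_comp_inv_smul_id {E : Type*} [NormedAddCommGroup E] [NormedSpace ℝ E] {c d : ℝ}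
    (h : c * d = 1) : (c • ContinuousLinearMap.id ℝ E) ∘L (d • ContinuousLinearMap.id ℝ E) =
      ContinuousLinearMap.id ℝ E := by
  ext x
  simp [smul_smul, mul_comm d c, h]

theorem chainPredictor_isNonsingularAt {T : ℝ} (hT : 0 < T)
    (z : EuclideanSpace ℝ ((Fin (k + 1) × Fin m) ⊕ Fin m)) :
    IsNonsingularAt (chainPredictor m k T) z := by
  refine ⟨(hasFDerivAt_chainPredictor T _ _).differentiableAt, ?_⟩
  have hc : T ^ (k + 1) / (Nat.factorial (k + 1) : ℝ) ≠ 0 := by positivity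
  rw [chainPredictor_inputJacobian]
  exact ContinuousLinearMap.IsInvertible.of_inverse
    (smul_id_comp_inv_smul_id (mul_inv_cancel₀ hc)) (smul_id_comp_inv_smul_id (inv_mul_cancel₀ hc))

theorem chain_closedLoopField {T : ℝ} (hT : 0 < T) (α : ℝ)
    (z : EuclideanSpace ℝ ((Fin (k + 1) × Fin m) ⊕ Fin m)) (ρ : EuclideanSpace ℝ (Fin m)) :
    closedLoopField (linearField (chainA m k) (chainB m k)) (chainPredictor m k T) α z ρ =
      augment (linearField (chainA m k) (chainB m k) (statePart z) (inputPart z))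
        ((α * ((Nat.factorial (k + 1) : ℝ) / T ^ (k + 1))) •
          (ρ - chainPredictor m k T (statePart z) (inputPart z))) := by
  have hc : T ^ (k + 1) / (Nat.factorial (k + 1) : ℝ) ≠ 0 := by positivity
  rw [closedLoopField, chainPredictor_inputJacobian, ContinuousLinearMap.inverse_eq
    (smul_id_comp_inv_smul_id (mul_inv_cancel₀ hc))
    (smul_id_comp_inv_smul_id (inv_mul_cancel₀ hc)), inv_div, mul_smul]
  rfl

theorem chain_closedLoopField_apply_inr {T : ℝ} (hT : 0 < T) (α : ℝ)
    (z : EuclideanSpace ℝ ((Fin (k + 1) × Fin m) ⊕ Fin m)) (ρ : EuclideanSpace ℝ (Fin m))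
    (a : Fin m) :
    closedLoopField (linearField (chainA m k) (chainB m k)) (chainPredictor m k T) α z ρ
      (Sum.inr a) = α * (((Nat.factorial (k + 1) : ℝ) / T ^ (k + 1)) * ρ a -
        ∑ i ∈ Finset.range (k + 2), (slowPoly k T).coeff i * chainCoord z a i) := by
  rw [chain_closedLoopField hT]
  simp only [augment, Sum.elim_inr, PiLp.smul_apply, PiLp.sub_apply, smul_eq_mul, chainPredictor]
  have h : ∑ i ∈ Finset.range (k + 2), (slowPoly k T).coeff i * chainCoord z a i =
      ((Nat.factorial (k + 1) : ℝ) / T ^ (k + 1)) * ∑ i ∈ Finset.range (k + 2),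
        T ^ i / (Nat.factorial i : ℝ) * chainCoord z a i := by
    rw [Finset.mul_sum]
    refine Finset.sum_congr rfl fun i hi => ?_
    rw [slowPoly_coeff, if_pos (Finset.mem_range.mp hi), mul_assoc]
  have h2 := augment_statePart_inputPart z
  rw [augment] at h2
  rw [h, h2]
  ring

theorem chain_closedLoopField_apply_inl {T : ℝ} (hT : 0 < T) (α : ℝ)
    (z : EuclideanSpace ℝ ((Fin (k + 1) × Fin m) ⊕ Fin m)) (ρ : EuclideanSpace ℝ (Fin m))
    (i : Fin (k + 1)) (a : Fin m) :
    closedLoopField (linearField (chainA m k) (chainB m k)) (chainPredictor m k T) α z ρ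
      (Sum.inl (i, a)) = chainCoord z a ((i : ℕ) + 1) := by
  rw [chain_closedLoopField hT, ← augment_statePart_inputPart z, ← chain_linearField_apply]
  rfl

theorem chain_closedLoopField_eq_augmented {T : ℝ} (hT : 0 < T) (α : ℝ)
    (z : EuclideanSpace ℝ ((Fin (k + 1) × Fin m) ⊕ Fin m)) (ρ : EuclideanSpace ℝ (Fin m)) :
    closedLoopField (linearField (chainA m k) (chainB m k)) (chainPredictor m k T) α z ρ =
      WithLp.toLp 2 ((augmentedMatrix (chainA m k) (chainB m k) (chainC m k) T α).mulVec z +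
        (referenceMatrix (chainA m k) (chainB m k) (chainC m k) T α).mulVec ρ) := by
  ext (⟨i, a⟩ | a)
  · rw [chain_closedLoopField hT]
    simp [augment, linearField, augmentedMatrix, referenceMatrix, Matrix.mulVec, dotProduct,
      statePart, inputPart]
  · rw [chain_closedLoopField_apply_inr hT, Finset.sum_range_succ, slowPoly_coeff_top k hT.ne',
      chainCoord_top]
    have h1 : ((referenceMatrix (chainA m k) (chainB m k) (chainC m k) T α).mulVec ρ)
        (Sum.inr a) = α * (((Nat.factorial (k + 1) : ℝ) / T ^ (k + 1)) * ρ a) := by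
      rw [referenceMatrix, Matrix.fromRows_mulVec, Sum.elim_inr, chainGain_inv m k hT.ne',
        smul_smul, Matrix.smul_mulVec, Matrix.one_mulVec, Pi.smul_apply, smul_eq_mul, mul_assoc]
    have h2 : ((augmentedMatrix (chainA m k) (chainB m k) (chainC m k) T α).mulVec z)
        (Sum.inr a) = -α * (∑ i ∈ Finset.range (k + 1), (slowPoly k T).coeff i *
          chainCoord z a i + z (Sum.inr a)) := by
      rw [Matrix.mulVec, dotProduct, Fintype.sum_sum_type, augmentedMatrix]
      simp only [Matrix.fromBlocks_apply₂₁, Matrix.fromBlocks_apply₂₂, Matrix.neg_apply,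
        Matrix.smul_apply, Matrix.map_apply, chainFeedback_apply hT.ne', Matrix.one_apply,
        Algebra.algebraMap_self, RingHom.id_apply, smul_eq_mul, Fintype.sum_prod_type]
      rw [mul_add, Finset.mul_sum, Finset.sum_range]
      congr 1
      · refine Finset.sum_congr rfl fun i _ => ?_
        rw [Finset.sum_eq_single a]
        · rw [slowPoly_coeff, if_pos rfl, if_pos (by omega), chainCoord_of_lt _ _ i.isLt]
          ring
        · intro b _ hb
          rw [if_neg hb.symm]
          ring
        · simp
      · simp
    refine Eq.trans ?_ (congrArg₂ (· + ·) h2 h1).symm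
    ring

end Predictor

/-! ### Well-posedness and `α`-stability of the closed loop -/

section Stability

open Set

variable {m k : ℕ}

theorem isPiecewiseContinuous_empty_of_continuousOn {E : Type*} [NormedAddCommGroup E]
    {p : ℝ → E} (hp : ContinuousOn p (Ici 0)) : IsPiecewiseContinuous ∅ p where
  finite b := by simp
  cont t ht := hp t ht.1
  right t ht := ⟨p t, (hp t ht).mono_left (nhdsWithin_mono t fun _ hx => ht.trans (le_of_lt hx))⟩
  left t ht := ⟨p t, (hp.continuousAt (Ici_mem_nhds ht)).continuousWithinAt⟩

/-- The reference at time `t + T`, extended to negative times `t` by its value at `T`. -/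
theorem continuous_shifted_reference {E : Type*} [NormedAddCommGroup E] [NormedSpace ℝ E]
    {r : ℝ → E} (hr : ContinuousOn r (Ici 0)) {T : ℝ} (hT : 0 < T) :
    Continuous fun t => r (max t 0 + T) :=
  hr.comp_continuous (by fun_prop) fun t => add_nonneg (le_max_right t 0) hT.le

theorem exists_chain_closedLoop_solution {T : ℝ} (hT : 0 < T) (α : ℝ)
    {r : ℝ → EuclideanSpace ℝ (Fin m)} (hr : ContinuousOn r (Ici 0))
    (z₀ : EuclideanSpace ℝ ((Fin (k + 1) × Fin m) ⊕ Fin m)) :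
    ∃ z : ℝ → EuclideanSpace ℝ ((Fin (k + 1) × Fin m) ⊕ Fin m), z 0 = z₀ ∧
      (∀ t, 0 ≤ t → HasDerivWithinAt z
        (closedLoopField (linearField (chainA m k) (chainB m k)) (chainPredictor m k T) α (z t)
          (r (t + T))) (Ici 0) t) ∧
      IsClosedLoopSolution (linearField (chainA m k) (chainB m k)) (chainPredictor m k T) T α r z₀
        z := by
  set M := Matrix.toEuclideanCLM (𝕜 := ℝ)
    (augmentedMatrix (chainA m k) (chainB m k) (chainC m k) T α) with hM
  set b : ℝ → EuclideanSpace ℝ ((Fin (k + 1) × Fin m) ⊕ Fin m) := fun t => WithLp.toLp 2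
    ((referenceMatrix (chainA m k) (chainB m k) (chainC m k) T α).mulVec (r (max t 0 + T))) with hb
  have hbc : Continuous b := by
    have h1 := continuous_shifted_reference hr hT
    have h2 : Continuous fun t => (r (max t 0 + T)).ofLp :=
      (PiLp.continuous_ofLp 2 _).comp h1
    exact (PiLp.continuous_toLp 2 _).comp (Continuous.matrix_mulVec continuous_const h2)
  obtain ⟨z, h0, hz⟩ := exists_linearODE_solution M hbc z₀
  have hfield : ∀ t, 0 ≤ t → M (z t) + b t =
      closedLoopField (linearField (chainA m k) (chainB m k)) (chainPredictor m k T) α (z t)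
          (r (t + T)) := by
    intro t ht
    rw [chain_closedLoopField_eq_augmented hT]
    ext i
    simp [hM, hb, Matrix.ofLp_toEuclideanCLM, max_eq_left ht]
  have hzc : Continuous z := continuous_iff_continuousAt.mpr fun t => (hz t).continuousAt
  refine ⟨z, h0, fun t ht => by rw [← hfield t ht]; exact (hz t).hasDerivWithinAt, h0, ∅,
    fun t => M (z t) + b t, ⟨hzc.continuousOn, isPiecewiseContinuous_empty_of_continuousOn
      ((M.continuous.comp hzc).add hbc).continuousOn, fun t _ => (hz t).hasDerivWithinAt⟩,
    fun t ht => ⟨chainPredictor_isNonsingularAt hT _, hfield t ht.1⟩⟩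

theorem IsPiecewiseContinuous.countable {E : Type*} [NormedAddCommGroup E]
    {S : Set ℝ} {p : ℝ → E} (h : IsPiecewiseContinuous S p) : (S ∩ Ici 0).Countable := by
  have : S ∩ Ici 0 ⊆ ⋃ n : ℕ, S ∩ Icc 0 (n : ℝ) := by
    rintro t ⟨hS, ht⟩
    obtain ⟨n, hn⟩ := exists_nat_ge t
    exact mem_iUnion.mpr ⟨n, hS, ht, hn⟩
  exact (countable_iUnion fun n : ℕ => (h.finite n).countable).mono this

/-- The reference cancels in the difference of two solutions, leaving a homogeneous linear equation
off a countable set. -/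
theorem chain_closedLoop_unique {T : ℝ} (hT : 0 < T) {α : ℝ}
    {r : ℝ → EuclideanSpace ℝ (Fin m)} {z₀ : EuclideanSpace ℝ ((Fin (k + 1) × Fin m) ⊕ Fin m)}
    {z w : ℝ → EuclideanSpace ℝ ((Fin (k + 1) × Fin m) ⊕ Fin m)} (hz0 : z 0 = z₀)
    (hz : ∀ t, 0 ≤ t → HasDerivWithinAt z
        (closedLoopField (linearField (chainA m k) (chainB m k)) (chainPredictor m k T) α (z t)
          (r (t + T))) (Ici 0) t)
    (hw : IsClosedLoopSolution (linearField (chainA m k) (chainB m k)) (chainPredictor m k T) T α r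
      z₀ w) : EqOn w z (Ici 0) := by
  obtain ⟨hw0, S, w', hwd, hw'⟩ := hw
  intro t ht
  refine sub_eq_zero.mp (linearODE_eq_zero_of_off_countable (Matrix.toEuclideanCLM (𝕜 := ℝ)
    (augmentedMatrix (chainA m k) (chainB m k) (chainC m k) T α)) (u := fun t => w t - z t)
    hwd.pcont.countable (hwd.cont.sub fun t ht => (hz t ht).continuousWithinAt)
    (by rw [hw0, hz0, sub_self]) (fun s hs => ?_) t ht)
  refine ((hwd.deriv s hs).sub (hz s hs.1)).congr_deriv ?_
  rw [(hw' s hs).2, chain_closedLoopField_eq_augmented hT, chain_closedLoopField_eq_augmented hT,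
    map_sub]
  ext i
  simp [Matrix.ofLp_toEuclideanCLM]

theorem chainEval_slowPoly_map (T : ℝ) (y : ℕ → ℝ → ℝ) (t : ℝ) :
    chainEval k ((slowPoly k T).map (algebraMap ℝ ℂ)) (fun i t => (y i t : ℂ)) t =
      ((∑ i ∈ Finset.range (k + 2), (slowPoly k T).coeff i * y i t : ℝ) : ℂ) := by
  simp [chainEval]

/-- Each output component is a scalar chain driven by `d r(t+T)`. It is viewed over `ℂ`, where `p`
splits, and the chain bound applies with constants independent of the component. -/
theorem exists_chain_closedLoop_bound (m : ℕ) (hk : k ≤ 3) {T : ℝ} (hT : 0 < T) :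
    ∃ αbar K : ℝ, 0 < αbar ∧ 0 ≤ K ∧ ∀ α, αbar < α →
      ∀ (r : ℝ → EuclideanSpace ℝ (Fin m)) (R : ℝ), (∀ t, 0 < t → ‖r t‖ ≤ R) →
      ∀ z : ℝ → EuclideanSpace ℝ ((Fin (k + 1) × Fin m) ⊕ Fin m),
      (∀ t, 0 ≤ t → HasDerivWithinAt z
        (closedLoopField (linearField (chainA m k) (chainB m k)) (chainPredictor m k T) α (z t)
          (r (t + T))) (Ici 0) t) →
      ∀ t, 0 ≤ t → ‖z t‖ ≤ K * (R + ‖z 0‖) := by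
  obtain ⟨αbar, K, hα, hK, hbound⟩ := exists_chain_bound (k := k)
    (f := (slowPoly k T).map (algebraMap ℝ ℂ)) ((slowPoly_monic k hT.ne').map _)
    (by rw [Polynomial.natDegree_map, slowPoly_natDegree k hT.ne'])
    (fun s hs => (isHurwitz_slowPoly_iff k hT).mpr hk s (by
      rwa [Polynomial.IsRoot.def, Polynomial.eval_map_algebraMap] at hs))
  set d : ℝ := (Nat.factorial (k + 1) : ℝ) / T ^ (k + 1) with hd
  have hd0 : 0 < d := by positivity
  set c : ℝ := (Fintype.card ((Fin (k + 1) × Fin m) ⊕ Fin m) : ℝ)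
  refine ⟨αbar, c * (K * (d + 1)), hα, by positivity, fun α hαα r R hR z hz t ht => ?_⟩
  have hR0 : 0 ≤ R := (norm_nonneg _).trans (hR 1 one_pos)
  have hcoord : ∀ (a : Fin m), ∀ i ≤ k + 1, ‖chainCoord (z t) a i‖ ≤ K * (‖z 0‖ + d * R) := by
    intro a i hi
    have h := hbound α hαα (fun i t => (chainCoord (z t) a i : ℂ))
      (fun t => ((d * r (t + T) a : ℝ) : ℂ)) ‖z 0‖ (d * R) ?_ ?_ ?_ ?_ t ht i hi
    · rwa [Complex.norm_real] at h
    · intro i hi t ht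
      have hi' : i < k + 1 := Nat.lt_succ_of_le hi
      have := hasDerivWithinAt_euclidean_apply (hz t ht) (Sum.inl (⟨i, hi'⟩, a))
      rw [chain_closedLoopField_apply_inl hT] at this
      simp only [chainCoord_of_lt _ _ hi']
      exact this.ofReal_comp
    · intro t ht
      have := hasDerivWithinAt_euclidean_apply (hz t ht) (Sum.inr a)
      rw [chain_closedLoopField_apply_inr hT, ← hd] at this
      rw [chainEval_slowPoly_map T fun i t => chainCoord (z t) a i]
      simp only [chainCoord_top]
      refine this.ofReal_comp.congr_deriv ?_
      push_cast
      rfl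
    · intro i _
      rw [Complex.norm_real]
      exact abs_chainCoord_le _ _ _
    · intro t ht
      rw [Complex.norm_real, norm_mul, Real.norm_of_nonneg hd0.le]
      exact mul_le_mul_of_nonneg_left
        ((PiLp.norm_apply_le _ a).trans (hR _ (add_pos_of_nonneg_of_pos ht hT))) hd0.le
  have hle : K * (‖z 0‖ + d * R) ≤ K * (d + 1) * (R + ‖z 0‖) := by
    rw [mul_assoc]
    refine mul_le_mul_of_nonneg_left ?_ hK
    nlinarith [mul_nonneg hd0.le (norm_nonneg (z 0))]
  rw [mul_assoc]
  refine euclidean_norm_le_card_mul (z t) (by positivity) fun i => ?_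
  refine le_trans ?_ hle
  rcases i with ⟨i, a⟩ | a
  · have := hcoord a i i.isLt.le
    rwa [chainCoord_of_lt _ _ i.isLt] at this
  · have := hcoord a (k + 1) le_rfl
    rwa [chainCoord_top] at this

theorem chain_alphaStable (m : ℕ) (hk : k ≤ 3) {T : ℝ} (hT : 0 < T) :
    AlphaStable (linearField (chainA m k) (chainB m k)) (chainPredictor m k T) T ⊤ ⊤ := by
  obtain ⟨αbar, K, hα, hK, hbound⟩ := exists_chain_closedLoop_bound m hk hT
  -- Linearity of the loop allows linear comparison functions with the same slope.
  refine ⟨αbar, hα, fun x => K.toNNReal * x, fun x => K.toNNReal * x, by fun_prop,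
    fun x y h => mul_le_mul_right h _, by fun_prop, fun x y h => mul_le_mul_right h _, ?_⟩
  intro α hαα r hr _ href z₀ _
  obtain ⟨-, S, r', hrd, -⟩ := href
  obtain ⟨z, hz0, hz, hsol⟩ := exists_chain_closedLoop_solution (k := k) hT α hrd.cont z₀
  refine ⟨z, hsol, fun w hw => chain_closedLoop_unique hT hz0 hz hw,
    fun t _ => chainPredictor_isNonsingularAt hT _, ?_⟩
  have hle := hbound α hαα r ‖hr.toLp r‖
    (fun t ht => norm_le_eLpNorm_of_continuousOn hr hrd.cont ht) z hz
  rw [MeasureTheory.eLpNorm_exponent_top]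
  have hae : ∀ᵐ t ∂timeMeasure, ‖z t‖ ≤ K * (‖hr.toLp r‖ + ‖z 0‖) :=
    MeasureTheory.ae_restrict_of_forall_mem measurableSet_Ici hle
  refine (MeasureTheory.eLpNormEssSup_le_of_ae_bound hae).trans (le_of_eq ?_)
  rw [hz0, ← mul_add, ENNReal.ofReal, Real.toNNReal_mul hK]
  congr 2
  exact Real.toNNReal_coe (r := ‖hr.toLp r‖₊ + ‖z₀‖₊)

end Stability

end FlatNR

theorem mainTheorem1 (m k : ℕ) (hm : 0 < m) (T : ℝ) (hT : 0 < T) :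
    -- the Newton-Raphson controller is well posed and the closed loop is the augmented linear system
    IsUnit (FlatNR.gain (FlatNR.chainA m k) (FlatNR.chainB m k) (FlatNR.chainC m k) T) ∧
    (∃ g : EuclideanSpace ℝ (Fin (k + 1) × Fin m) → EuclideanSpace ℝ (Fin m) →
        EuclideanSpace ℝ (Fin m),
      FlatNR.IsPredictor (FlatNR.linearField (FlatNR.chainA m k) (FlatNR.chainB m k))
        (FlatNR.linearOutput (FlatNR.chainC m k)) T g ∧
      (∀ (α : ℝ) (z : EuclideanSpace ℝ ((Fin (k + 1) × Fin m) ⊕ Fin m))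
          (ρ : EuclideanSpace ℝ (Fin m)),
        FlatNR.closedLoopField (FlatNR.linearField (FlatNR.chainA m k) (FlatNR.chainB m k)) g α z ρ =
          WithLp.toLp 2
            ((FlatNR.augmentedMatrix (FlatNR.chainA m k) (FlatNR.chainB m k)
                (FlatNR.chainC m k) T α).mulVec z +
              (FlatNR.referenceMatrix (FlatNR.chainA m k) (FlatNR.chainB m k)
                (FlatNR.chainC m k) T α).mulVec ρ)) ∧
      -- `α`-stability with respect to all of `L^∞` and all initial conditions
      (k ≤ 3 → FlatNR.AlphaStable
        (FlatNR.linearField (FlatNR.chainA m k) (FlatNR.chainB m k)) g T ⊤ ⊤)) ∧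
    -- the closed-loop characteristic polynomial
    (∀ α : ℝ,
      FlatNR.charPoly (FlatNR.chainA m k) (FlatNR.chainB m k) (FlatNR.chainC m k) T α =
        (Polynomial.X ^ (k + 2) +
          Polynomial.C (α * ((Nat.factorial (k + 1) : ℝ) / T ^ (k + 1))) *
            ∑ i ∈ Finset.range (k + 2),
              Polynomial.C (T ^ i / (Nat.factorial i : ℝ)) * Polynomial.X ^ i) ^ m) ∧
    -- the polynomial `P_0`
    FlatNR.charPolyCoeff (FlatNR.chainA m k) (FlatNR.chainB m k) (FlatNR.chainC m k) T 0 =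
      (Polynomial.C ((Nat.factorial (k + 1) : ℝ) / T ^ (k + 1)) *
        ∑ i ∈ Finset.range (k + 2),
          Polynomial.C (T ^ i / (Nat.factorial i : ℝ)) * Polynomial.X ^ i) ^ m ∧
    (FlatNR.IsHurwitz
        (FlatNR.charPolyCoeff (FlatNR.chainA m k) (FlatNR.chainB m k) (FlatNR.chainC m k) T 0) ↔
      k ≤ 3) ∧
    -- the polynomial `Q`
    FlatNR.fastPoly (FlatNR.chainA m k) (FlatNR.chainB m k) (FlatNR.chainC m k) T =
      algebraMap (Polynomial ℝ) (RatFunc ℝ) ((Polynomial.X + 1) ^ m) := by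
  refine ⟨FlatNR.isUnit_chainGain m k hT.ne',
    ⟨FlatNR.chainPredictor m k T, FlatNR.isPredictor_chainPredictor m k hT,
      FlatNR.chain_closedLoopField_eq_augmented hT, fun hk => FlatNR.chain_alphaStable m hk hT⟩,
    FlatNR.chain_charPoly m k hT.ne', FlatNR.chain_charPolyCoeff_zero m k hT.ne', ?_,
    FlatNR.chain_fastPoly m k hT.ne'⟩
  rw [FlatNR.chain_charPolyCoeff_zero m k hT.ne', FlatNR.isHurwitz_pow_iff hm.ne',
    FlatNR.isHurwitz_slowPoly_iff k hT]
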